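/- Let $\tau$ be in the upper half-plane, $\Lambda=\mathbb{Z}+\mathbb{Z}\tau$, $\mathbb{T}=\mathbb{C}/\Lambda$, let $\wp$ be the Weierstrass function of $\Lambda$, and let $\gamma=[\tfrac{\tau}{2},\tfrac{\tau}{2}+1]$ be oriented from $\tfrac{\tau}{2}$ to $\tfrac{\tau}{2}+1$. Put $\mathcal{E}_{2k}=\wp^k$ and $\mathcal{E}_{2k+3}=-\tfrac12\wp'\wp^k$ for $k\ge 0$, $\mu_{i,j}=\int_\gamma \mathcal{E}_i\mathcal{E}_j\,dz$, and $D_n=\det(\mu_{i,j})$ with $i,j\in\{0,2,3,\dots,n-1\}$. If $D_n\neq 0$, let $$\pi_n(z)=\frac{1}{D_n}\det\begin{pmatrix}(\mu_{i,j})_{i\in\{0,2,\dots,n-1\}}\\ \mathcal{E}_j(z)\end{pmatrix}_{j\in\{0,2,3,\dots,n\}},\qquad h_n=\int_\gamma \pi_n(z)^2\,dz,$$ that is, $\pi_n$ is the monic elliptic orthogonal polynomial of degree $n$ for the constant weight $1$ on $\gamma$, and $h_n$ is its norm. A solution of the Riemann--Hilbert problem of index $n$ is a $2\times 2$ matrix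 function $Y_n$, analytic on $\mathbb{T}\setminus(\gamma\cup\{0\})$, whose limits $Y_{n,\pm}$ on $\gamma$ from the left ($+$) and from the right ($-$) exist and satisfy $Y_{n,+}=Y_{n,-}\begin{pmatrix}1&1\\0&1\end{pmatrix}$, and such that $Y_n(z)=(\mathbb{1}+\mathcal{O}(z))\begin{pmatrix}z^{-n}&0\\0&z^{n-2}\end{pmatrix}$ as $z\to 0$. **Proposition.** Let $n\ge 3$, suppose that $D_n\ne 0$ and $D_{n+1}\neq 0$, let $Y_n$ and $Y_{n+1}$ be solutions of the Riemann--Hilbert problems of index $n$ and $n+1$, and let $f_n=\det Y_n$ and $f_{n+1}=\det Y_{n+1}$. Then $$Y_{n+1}=R_nY_n,\qquad R_n=\frac{1}{f_n}\begin{pmatrix}-\tfrac12\wp' & -\dfrac{h_n}{2\pi i}f_{n+1}\\[2mm] \dfrac{2\pi i}{h_n}f_n & 0\end{pmatrix}$$ at every point of $\mathbb{T}\setminus(\gamma\cup\{0\})$ where $f_n\neq 0$. Moreover, for $m=n$ and $m=n+1$ there are constants $c_{2,m}$ and $\widetilde c_{2,m-1}$ such that, as $z\to 0$, $$(Y_m)_{11}(z)=z^{-m}\bigl(1+c_{2,m}z^2+\mathcal{O}(z^3)\bigr),\qquad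 (Y_m)_{22}(z)=z^{m-2}\bigl(1+\widetilde c_{2,m-1}z^2+\mathcal{O}(z^3)\bigr),$$ and $f_m=\wp+\alpha_m$ on $\mathbb{T}\setminus(\gamma\cup\{0\})$ with $\alpha_m=c_{2,m}+\widetilde c_{2,m-1}-\dfrac{h_m}{h_{m-1}}$, where the quotient $h_m/h_{m-1}$ is read as $0$ if $D_{m-1}=0$. -/

import Mathlib

open Filter Topology Asymptotics

noncomputable section

namespace EllipticOP

/-- The pair of periods `(1, τ)`, with `τ` in the upper half-plane. -/
def periods (τ : UpperHalfPlane) : PeriodPair where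
  ω₁ := 1
  ω₂ := (τ : ℂ)
  indep := by
    rw [LinearIndependent.pair_iff]
    intro s t h
    have him := congrArg Complex.im h
    have hre := congrArg Complex.re h
    have ht : t = 0 := by
      rcases (by simpa using him : t = 0 ∨ τ.im = 0) with h0 | h0
      · exact h0
      · exact absurd h0 τ.im_pos.ne'
    subst ht
    exact ⟨by simpa using hre, rfl⟩

/-- The lattice `ℤ + ℤ τ`. -/
def Λ (τ : UpperHalfPlane) : Submodule ℤ ℂ := (periods τ).lattice

/-- The Weierstrass function `℘` of the lattice `ℤ + ℤ τ`. -/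
def wp (τ : UpperHalfPlane) : ℂ → ℂ := (periods τ).weierstrassP

/-- The derivative `℘'` of the Weierstrass function. -/
def wp' (τ : UpperHalfPlane) : ℂ → ℂ := (periods τ).derivWeierstrassP

/-- The parametrisation of the contour `γ = [τ/2, τ/2 + 1]`, oriented from `τ/2` to `τ/2 + 1`,
by `t ∈ [0, 1]`. -/
def γ (τ : UpperHalfPlane) (t : ℝ) : ℂ := (τ : ℂ) / 2 + t

/-- The integral `∫_γ g(z) dz`. -/
def integralγ (τ : UpperHalfPlane) (g : ℂ → ℂ) : ℂ := ∫ t in (0 : ℝ)..1, g (γ τ t)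

/-- The basis of elliptic polynomials: `E (2k) = ℘ ^ k` and `E (2k+3) = -(1/2) ℘' ℘ ^ k`.
There is no elliptic polynomial of degree one: the value at index `1` is never used. -/
def E (τ : UpperHalfPlane) (n : ℕ) (z : ℂ) : ℂ :=
  if Even n then wp τ z ^ (n / 2) else -(1 / 2) * wp' τ z * wp τ z ^ ((n - 3) / 2)

/-- The moments `μ i j = ∫_γ E_i E_j dz` of the constant weight `1`. -/
def moment (τ : UpperHalfPlane) (i j : ℕ) : ℂ := integralγ τ fun z => E τ i z * E τ j z

/-- The set of degrees `{0, 2, 3, …, n - 1}`. -/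
abbrev Idx (n : ℕ) : Type := {i // i ∈ (Finset.range n).erase 1}

/-- The moment determinant `D_n = det (μ i j)`, with `i, j` in `{0, 2, 3, …, n - 1}`. -/
def D (τ : UpperHalfPlane) (n : ℕ) : ℂ :=
  (Matrix.of fun i j : Idx n => moment τ i j).det

/-- The monic elliptic orthogonal polynomial `π_n` (for `n ≠ 1` and `D_n ≠ 0`): `D_n⁻¹` times the
determinant over `{0, 2, 3, …, n}` whose rows `i < n` are the moments `μ i j` and whose last row
is `E_j(z)`. -/
def eop (τ : UpperHalfPlane) (n : ℕ) (z : ℂ) : ℂ :=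
  (D τ n)⁻¹ *
    (Matrix.of fun i j : Idx (n + 1) => if (i : ℕ) = n then E τ j z else moment τ i j).det

/-- The norm `h_n = ∫_γ π_n² dz`. -/
def h (τ : UpperHalfPlane) (n : ℕ) : ℂ := integralγ τ fun z => eop τ n z ^ 2

/-- The preimage in `ℂ` of the torus `ℂ / (ℤ + ℤ τ)` with the point `0` and the contour `γ`
removed. -/
def domain (τ : UpperHalfPlane) : Set ℂ :=
  {z | z ∉ Λ τ ∧ ∀ t ∈ Set.Icc (0 : ℝ) 1, z - γ τ t ∉ Λ τ}

/-- `Y` solves the Riemann-Hilbert problem of index `n` for the constant weight `1`. A function on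
the torus is a doubly periodic function on the plane; its values outside `domain τ` play no
role. -/
structure IsRHPSolution (τ : UpperHalfPlane) (n : ℕ) (Y : ℂ → Matrix (Fin 2) (Fin 2) ℂ) :
    Prop where
  /-- `Y` is a function on the torus. -/
  periodic : ∀ z ∈ domain τ, ∀ l ∈ Λ τ, Y (z + l) = Y z
  /-- `Y` is analytic off the contour and the origin. -/
  analytic : ∀ i j, AnalyticOnNhd ℂ (fun z => Y z i j) (domain τ)
  /-- On `γ`, the limits `Yp` from the left (above) and `Ym` from the right (below) exist, and
  satisfy the jump condition. -/
  jump : ∀ t ∈ Set.Icc (0 : ℝ) 1, ∃ Yp Ym : Matrix (Fin 2) (Fin 2) ℂ,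
    Tendsto Y (𝓝[{z | (γ τ t).im < z.im}] (γ τ t)) (𝓝 Yp) ∧
    Tendsto Y (𝓝[{z | z.im < (γ τ t).im}] (γ τ t)) (𝓝 Ym) ∧
    Yp = Ym * !![1, 1; 0, 1]
  /-- `Y(z) diag(z^n, z^(2-n)) = 1 + O(z)` as `z → 0`. -/
  asymp : ∀ i j, (fun z : ℂ =>
      (Y z * Matrix.diagonal ![z ^ (n : ℤ), z ^ (2 - n : ℤ)]) i j
        - (1 : Matrix (Fin 2) (Fin 2) ℂ) i j) =O[𝓝[≠] 0] fun z : ℂ => z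

/-- The matrix `R_n(z)`, with `f = f_n` and `f₁ = f_{n+1}`. -/
def R (τ : UpperHalfPlane) (n : ℕ) (f f₁ : ℂ → ℂ) (z : ℂ) : Matrix (Fin 2) (Fin 2) ℂ :=
  (1 / f z) •
    !![-(wp' τ z) / 2, -(h τ n / (2 * Real.pi * Complex.I)) * f₁ z;
      (2 * Real.pi * Complex.I / h τ n) * f z, 0]

/-- `α` is the constant `α_n = c_{2,n} + c̃_{2,n-1} - h_n / h_{n-1}`, where `Y` is the solution of
index `n` and, as `z → 0`,
`Y₁₁(z) = z^(-n) (1 + c_{2,n} z² + O(z³))` and `Y₂₂(z) = z^(n-2) (1 + c̃_{2,n-1} z² + O(z³))`.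
The norm `h_{n-1}` is defined only if `D_{n-1} ≠ 0`; the quotient `h_n / h_{n-1}` is
`h_n D_{n-1} / D_n`, which only needs `D_n ≠ 0`, so it is written in the latter form if
`D_{n-1} = 0`, where it vanishes. -/
def IsAlpha (τ : UpperHalfPlane) (n : ℕ) (Y : ℂ → Matrix (Fin 2) (Fin 2) ℂ) (α : ℂ) : Prop :=
  ∃ c c' : ℂ,
    (fun z : ℂ => z ^ (n : ℤ) * Y z 0 0 - (1 + c * z ^ 2)) =O[𝓝[≠] 0] (fun z : ℂ => z ^ 3) ∧
    (fun z : ℂ => z ^ (2 - n : ℤ) * Y z 1 1 - (1 + c' * z ^ 2)) =O[𝓝[≠] 0] (fun z : ℂ => z ^ 3) ∧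
    α = c + c' - if D τ (n - 1) = 0 then 0 else h τ n / h τ (n - 1)

end EllipticOP

end

/-!
In a row `(u, v)` of a solution the entry `u` has no jump, hence is an elliptic polynomial, while
`v` jumps by `u`. The residue theorem on the torus cut along `γ`, applied to `v * E i`, therefore
computes `∫_γ u E_i`: it vanishes for `i` small and is `2πi` times the leading coefficient of `v`
for the first `i` at which the pole of `v * E i` at the origin is simple. A nonvanishing moment
determinant makes the elliptic polynomials with such orthogonality relations unique; this gives
the parity of `u` and `v`, the value of `h`, and the proportionality of the second row for `n + 1`
to the first row for `n`. Finally `u v' - v u'` has no jump for any two rows `(u, v)`, `(u', v')`,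
so it is an elliptic polynomial, determined by its expansion at the origin. This gives `det Y`
and `R`.
-/

namespace EllipticOP

/-- `G` is a function on the closed cylinder `{z | a ≤ im z ≤ b} / ℤ`, continuous up to the
boundary and analytic inside. -/
structure PeriodicOnStrip (a b : ℝ) (G : ℂ → ℂ) : Prop where
  diffContOnCl : DiffContOnCl ℂ G (Complex.im ⁻¹' Set.Ioo a b)
  add_one : ∀ z, z.im ∈ Set.Icc a b → G (z + 1) = G z

lemma closure_im_preimage_Ioo {a b : ℝ} (hab : a < b) :
    closure (Complex.im ⁻¹' Set.Ioo a b) = Complex.im ⁻¹' Set.Icc a b := by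
  rw [Complex.closure_preimage_im, closure_Ioo hab.ne]

lemma eq_of_intervalIntegral_cexp_mul_eq_zero {p : ℝ → ℂ} (hp : Continuous p)
    (hper : Function.Periodic p 1)
    (h : ∀ k : ℤ, k ≠ 0 →
      ∫ t in (0 : ℝ)..1, Complex.exp (2 * Real.pi * Complex.I * k * t) * p t = 0) (s t : ℝ) :
    p s = p t := by
  have : Fact ((0 : ℝ) < 1) := ⟨one_pos⟩
  let f : C(AddCircle (1 : ℝ), ℂ) := ⟨hper.lift, continuous_coinduced_dom.2 hp⟩
  have hf (x : ℝ) : f (x : AddCircle (1 : ℝ)) = p x := hper.lift_coe x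
  have hcoeff (k : ℤ) (hk : k ≠ 0) : fourierCoeff f k = 0 := by
    rw [fourierCoeff_eq_intervalIntegral f k 0, zero_add, div_one, one_smul,
      ← h (-k) (neg_ne_zero.2 hk)]
    refine intervalIntegral.integral_congr fun x _ => ?_
    rw [hf, fourier_coe_apply, smul_eq_mul, Complex.ofReal_one, div_one]
  have hsum : Summable (fourierCoeff f) :=
    summable_of_ne_finset_zero (s := {0}) fun k hk => hcoeff k (by simpa using hk)
  have hconst (x : AddCircle (1 : ℝ)) : f x = fourierCoeff f 0 := by
    refine (has_pointwise_sum_fourier_series_of_summable hsum x).unique ?_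
    simpa using hasSum_single (f := fun i => fourierCoeff f i • fourier i x) 0
      fun k hk => by rw [hcoeff k hk, zero_smul]
  rw [← hf, ← hf, hconst, hconst]

lemma integral_cexp_mul_add (c z : ℂ) (f : ℝ → ℂ) :
    ∫ t : ℝ in (0 : ℝ)..1, Complex.exp (c * (z + t)) * f t =
      Complex.exp (c * z) * ∫ t : ℝ in (0 : ℝ)..1, Complex.exp (c * t) * f t := by
  simp only [mul_add, Complex.exp_add, mul_assoc, intervalIntegral.integral_const_mul]

namespace PeriodicOnStrip

variable {a b : ℝ} {G : ℂ → ℂ} {z w : ℂ}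

lemma continuousOn (hG : PeriodicOnStrip a b G) (hab : a < b) :
    ContinuousOn G (Complex.im ⁻¹' Set.Icc a b) :=
  closure_im_preimage_Ioo hab ▸ hG.diffContOnCl.continuousOn

lemma continuous_line (hG : PeriodicOnStrip a b G) (hab : a < b) (hz : z.im ∈ Set.Icc a b) :
    Continuous fun t : ℝ => G (z + t) :=
  (hG.continuousOn hab).comp_continuous (by fun_prop) fun t => by simpa using hz

lemma periodic_line (hG : PeriodicOnStrip a b G) (hz : z.im ∈ Set.Icc a b) :
    Function.Periodic (fun t : ℝ => G (z + t)) 1 := fun t => by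
  simpa [add_assoc] using hG.add_one (z + t) (by simpa using hz)

lemma integral_line (hG : PeriodicOnStrip a b G) (hz : z.im ∈ Set.Icc a b) (c : ℝ) :
    ∫ x : ℝ in c..c + 1, G (x + z.im * Complex.I) = ∫ t : ℝ in (0 : ℝ)..1, G (z + t) := by
  have hper : Function.Periodic (fun x : ℝ => G (x + z.im * Complex.I)) 1 := fun x => by
    beta_reduce
    rw [Complex.ofReal_add, Complex.ofReal_one, add_right_comm]
    exact hG.add_one _ (by simpa using hz)
  calc ∫ x : ℝ in c..c + 1, G (x + z.im * Complex.I)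
      = ∫ x : ℝ in z.re..z.re + 1, G (x + z.im * Complex.I) :=
        hper.intervalIntegral_add_eq c z.re
    _ = ∫ t : ℝ in (0 : ℝ)..1, G ((t + z.re : ℝ) + z.im * Complex.I) := by
        rw [intervalIntegral.integral_comp_add_right
          (fun x : ℝ => G (x + z.im * Complex.I)), zero_add, add_comm 1]
    _ = ∫ t : ℝ in (0 : ℝ)..1, G (z + t) := by
        refine intervalIntegral.integral_congr fun t _ => congrArg G ?_
        rw [Complex.ofReal_add, add_assoc, Complex.re_add_im, add_comm]

/-- The two vertical sides of a period rectangle cancel in Cauchy's theorem. -/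
lemma integral_eq (hG : PeriodicOnStrip a b G) (hab : a < b) (hz : z.im ∈ Set.Icc a b)
    (hw : w.im ∈ Set.Icc a b) :
    ∫ t : ℝ in (0 : ℝ)..1, G (z + t) = ∫ t : ℝ in (0 : ℝ)..1, G (w + t) := by
  have him : Set.uIcc z.im w.im ⊆ Set.Icc a b := Set.uIcc_subset_Icc hz hw
  have hrect := Complex.integral_boundary_rect_eq_zero_of_continuousOn_of_differentiableOn G z
    ⟨z.re + 1, w.im⟩ ((hG.continuousOn hab).mono fun x hx => him hx.2)
    (hG.diffContOnCl.differentiableOn.mono fun x hx =>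
      Set.Ioo_subset_Ioo (le_min hz.1 hw.1) (max_le hz.2 hw.2) hx.2)
  have hvert : ∫ y : ℝ in z.im..w.im, G ((z.re + 1 : ℝ) + y * Complex.I) =
      ∫ y : ℝ in z.im..w.im, G (z.re + y * Complex.I) :=
    intervalIntegral.integral_congr fun y hy => by
      have := hG.add_one (z.re + y * Complex.I) (by simpa using him hy)
      rwa [add_right_comm, ← Complex.ofReal_one, ← Complex.ofReal_add] at this
  rw [hvert, add_sub_cancel_right, hG.integral_line hz, hG.integral_line hw] at hrect
  exact sub_eq_zero.1 hrect

lemma cexp_mul (hG : PeriodicOnStrip a b G) (k : ℤ) :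
    PeriodicOnStrip a b fun z => Complex.exp (2 * Real.pi * Complex.I * k * z) * G z where
  diffContOnCl := by
    have hexp : Differentiable ℂ fun z : ℂ => Complex.exp (2 * Real.pi * Complex.I * k * z) := by
      fun_prop
    exact hexp.diffContOnCl.smul hG.diffContOnCl
  add_one z hz := by
    rw [hG.add_one z hz, mul_add, Complex.exp_add, mul_one, mul_comm _ (k : ℂ),
      Complex.exp_int_mul_two_pi_mul_I, mul_one]

/-- Passing from the lower to the upper edge would multiply a nonzero coefficient by
`exp (-2πikw) ≠ 1`. -/
lemma integral_cexp_mul_eq_zero (hG : PeriodicOnStrip a b G) (hab : a < b)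
    (hw : w.im = b - a) (hGw : ∀ z, z.im = a → G (z + w) = G z) {k : ℤ} (hk : k ≠ 0)
    (hz : z.im ∈ Set.Icc a b) :
    ∫ t : ℝ in (0 : ℝ)..1, Complex.exp (2 * Real.pi * Complex.I * k * t) * G (z + t) = 0 := by
  set c : ℂ := 2 * Real.pi * Complex.I * k with hc
  set J : ℂ → ℂ := fun z => ∫ t : ℝ in (0 : ℝ)..1, Complex.exp (c * t) * G (z + t)
  have hexp {x y : ℂ} (hx : x.im ∈ Set.Icc a b) (hy : y.im ∈ Set.Icc a b) :
      Complex.exp (c * x) * J x = Complex.exp (c * y) * J y := by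
    simpa only [integral_cexp_mul_add] using (hG.cexp_mul k).integral_eq hab hx hy
  set p : ℂ := a * Complex.I with hp
  have hpa : p.im = a := by simp [hp]
  have hp_mem : p.im ∈ Set.Icc a b := by simp [hpa, hab.le]
  have hJw : J (p + w) = J p := intervalIntegral.integral_congr fun t _ => by
    rw [add_right_comm, hGw _ (by simp [hpa])]
  have hne : Complex.exp (c * w) ≠ 1 := fun h1 => by
    have := congrArg norm h1
    rw [Complex.norm_exp, norm_one, Real.exp_eq_one_iff] at this
    simp [hc, hw, Real.pi_ne_zero, hk, sub_eq_zero, hab.ne'] at this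
  have hJp : J p = 0 := by
    have := hexp (x := p + w) (by simp [hpa, hw, hab.le]) hp_mem
    rw [hJw, mul_add, Complex.exp_add, mul_assoc] at this
    have := mul_left_cancel₀ (Complex.exp_ne_zero _) this
    exact by_contra fun h0 => hne ((mul_eq_right₀ h0).1 this)
  have := hexp hz hp_mem
  rw [hJp, mul_zero] at this
  exact (mul_eq_zero.1 this).resolve_left (Complex.exp_ne_zero _)

theorem eq_of_add_period (hG : PeriodicOnStrip a b G) (hab : a < b) (hw : w.im = b - a)
    (hGw : ∀ z, z.im = a → G (z + w) = G z) {z z' : ℂ} (hz : z.im ∈ Set.Icc a b)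
    (hz' : z'.im ∈ Set.Icc a b) : G z = G z' := by
  have hmean {z : ℂ} (hz : z.im ∈ Set.Icc a b) : ∫ t : ℝ in (0 : ℝ)..1, G (z + t) = G z := by
    have hconst (t : ℝ) : G (z + t) = G (z + (0 : ℝ)) :=
      eq_of_intervalIntegral_cexp_mul_eq_zero (hG.continuous_line hab hz) (hG.periodic_line hz)
        (fun k hk => hG.integral_cexp_mul_eq_zero hab hw hGw hk hz) t 0
    simp [hconst]
  rw [← hmean hz, ← hmean hz', hG.integral_eq hab hz hz']

end PeriodicOnStrip

lemma eventually_mem_diff {U S : Set ℂ} {z : ℂ} (hU : IsOpen U)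
    (hS : ∀ z, ∀ᶠ w in 𝓝[≠] z, w ∉ S) (hz : z ∈ U) : ∀ᶠ w in 𝓝[≠] z, w ∈ U \ S :=
  (eventually_nhdsWithin_of_eventually_nhds (hU.eventually_mem hz)).and (hS z)

lemma closure_subset_closure_diff {U S : Set ℂ} (hU : IsOpen U)
    (hS : ∀ z, ∀ᶠ w in 𝓝[≠] z, w ∉ S) : closure U ⊆ closure (U \ S) :=
  closure_minimal (fun _ hz => mem_closure_iff_frequently.2
    ((eventually_mem_diff hU hS hz).frequently.filter_mono nhdsWithin_le_nhds)) isClosed_closure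

lemma extendFrom_diff_eq {U S : Set ℂ} {F : ℂ → ℂ} {z y : ℂ} (hU : IsOpen U)
    (hS : ∀ z, ∀ᶠ w in 𝓝[≠] z, w ∉ S) (hz : z ∈ closure U) (hy : Tendsto F (𝓝[U \ S] z) (𝓝 y)) :
    extendFrom (U \ S) F z = y :=
  extendFrom_eq (closure_subset_closure_diff hU hS hz) hy

/-- Riemann's theorem on removable singularities, with continuity up to the boundary. -/
lemma diffContOnCl_extendFrom {U S : Set ℂ} {F : ℂ → ℂ} (hU : IsOpen U)
    (hS : ∀ z, ∀ᶠ w in 𝓝[≠] z, w ∉ S) (hF : ∀ z ∈ U \ S, DifferentiableAt ℂ F z)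
    (hlim : ∀ z ∈ closure U, ∃ y, Tendsto F (𝓝[U \ S] z) (𝓝 y)) :
    DiffContOnCl ℂ (extendFrom (U \ S) F) U := by
  have hcont : ContinuousOn (extendFrom (U \ S) F) (closure U) :=
    continuousOn_extendFrom (closure_subset_closure_diff hU hS) hlim
  have heq {z : ℂ} (hz : z ∈ U \ S) : extendFrom (U \ S) F z = F z :=
    extendFrom_diff_eq hU hS (subset_closure hz.1)
      ((hF z hz).continuousAt.tendsto.mono_left nhdsWithin_le_nhds)
  have hopen {z : ℂ} (hz : z ∈ U \ S) : ∀ᶠ w in 𝓝 z, w ∈ U \ S := by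
    rw [← Set.insert_eq_of_mem hz]
    exact insert_mem_nhds_iff.2 (eventually_mem_diff hU hS hz.1)
  refine ⟨fun z hz => ?_, hcont⟩
  refine (Complex.analyticAt_of_differentiable_on_punctured_nhds_of_continuousAt ?_
    (hcont.continuousAt (mem_of_superset (hU.mem_nhds hz) subset_closure))
    ).differentiableAt.differentiableWithinAt
  filter_upwards [eventually_mem_diff hU hS hz] with w hw
  exact (hF w hw).congr_of_eventuallyEq ((hopen hw).mono fun _ => heq)

/-- Near `0`, `F z = z ^ k * (c + O(z))` with an analytic bracket. The coefficient `c` may vanish,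
so this bounds the order of `F` at `0` from below by `k`. -/
def HasLeadingTerm (F : ℂ → ℂ) (k : ℤ) (c : ℂ) : Prop :=
  ∃ g : ℂ → ℂ, AnalyticAt ℂ g 0 ∧ g 0 = c ∧ ∀ᶠ z in 𝓝[≠] 0, F z = z ^ k * g z

lemma tendsto_neg_nhdsNE_zero : Tendsto (fun z : ℂ => -z) (𝓝[≠] 0) (𝓝[≠] 0) :=
  tendsto_nhdsWithin_iff.2 ⟨Continuous.tendsto' (by fun_prop) _ _ neg_zero |>.mono_left
    nhdsWithin_le_nhds, eventually_mem_nhdsWithin.mono fun _ => neg_ne_zero.2⟩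

namespace HasLeadingTerm

variable {F G : ℂ → ℂ} {k l : ℤ} {c d : ℂ}

lemma congr (hF : HasLeadingTerm F k c) (hFG : F =ᶠ[𝓝[≠] 0] G) : HasLeadingTerm G k c := by
  obtain ⟨g, hg, hg0, hgF⟩ := hF
  exact ⟨g, hg, hg0, hFG.symm.trans hgF⟩

lemma zpow (k : ℤ) : HasLeadingTerm (fun z => z ^ k) k 1 :=
  ⟨fun _ => 1, analyticAt_const, rfl, by simp⟩

lemma const (c : ℂ) : HasLeadingTerm (fun _ => c) 0 c :=
  ⟨fun _ => c, analyticAt_const, rfl, by simp⟩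

lemma mul (hF : HasLeadingTerm F k c) (hG : HasLeadingTerm G l d) :
    HasLeadingTerm (fun z => F z * G z) (k + l) (c * d) := by
  obtain ⟨f, hf, rfl, hfF⟩ := hF
  obtain ⟨g, hg, rfl, hgG⟩ := hG
  refine ⟨fun z => f z * g z, hf.mul hg, rfl, ?_⟩
  filter_upwards [hfF, hgG, self_mem_nhdsWithin] with z hz hz' hz0
  rw [hz, hz', zpow_add₀ hz0, mul_mul_mul_comm]

lemma add (hF : HasLeadingTerm F k c) (hG : HasLeadingTerm G k d) :
    HasLeadingTerm (fun z => F z + G z) k (c + d) := by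
  obtain ⟨f, hf, rfl, hfF⟩ := hF
  obtain ⟨g, hg, rfl, hgG⟩ := hG
  refine ⟨fun z => f z + g z, hf.add hg, rfl, ?_⟩
  filter_upwards [hfF, hgG] with z hz hz'
  rw [hz, hz', mul_add]

lemma sum {ι : Type*} (s : Finset ι) {F : ι → ℂ → ℂ} {c : ι → ℂ}
    (hF : ∀ i ∈ s, HasLeadingTerm (F i) k (c i)) :
    HasLeadingTerm (fun z => ∑ i ∈ s, F i z) k (∑ i ∈ s, c i) := by
  choose! f hf hf0 hfF using hF
  refine ⟨fun z => ∑ i ∈ s, f i z, Finset.analyticAt_fun_sum s hf, Finset.sum_congr rfl hf0, ?_⟩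
  filter_upwards [(eventually_all_finset s).2 hfF] with z hz
  rw [Finset.mul_sum, Finset.sum_congr rfl hz]

lemma const_mul (hF : HasLeadingTerm F k c) (d : ℂ) :
    HasLeadingTerm (fun z => d * F z) k (d * c) := by
  simpa only [zero_add] using (const d).mul hF

lemma sub (hF : HasLeadingTerm F k c) (hG : HasLeadingTerm G k d) :
    HasLeadingTerm (fun z => F z - G z) k (c - d) := by
  simpa only [neg_one_mul, ← sub_eq_add_neg] using hF.add (hG.const_mul (-1))

lemma pow (hF : HasLeadingTerm F k c) (m : ℕ) :
    HasLeadingTerm (fun z => F z ^ m) (m * k) (c ^ m) := by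
  induction m with
  | zero => simpa using const 1
  | succ m ih => simpa only [pow_succ, Nat.cast_succ, add_mul, one_mul] using ih.mul hF

lemma of_lt (hF : HasLeadingTerm F k c) (hlk : l < k) : HasLeadingTerm F l 0 := by
  obtain ⟨f, hf, -, hfF⟩ := hF
  obtain ⟨m, rfl⟩ : ∃ m : ℕ, k = l + (m + 1 : ℕ) := ⟨(k - l - 1).toNat, by omega⟩
  refine ⟨fun z => z ^ (m + 1) * f z, (analyticAt_id.pow _).mul hf, by simp, ?_⟩
  filter_upwards [hfF, self_mem_nhdsWithin] with z hz hz0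
  rw [hz, zpow_add₀ hz0, zpow_natCast, mul_assoc]

lemma of_deriv {f : ℂ → ℂ} (hf : AnalyticAt ℂ f 0) (hf0 : f 0 = 0) :
    HasLeadingTerm f 1 (deriv f 0) := by
  obtain ⟨p, hp⟩ := hf
  refine ⟨dslope f 0, ⟨_, hp.has_fpower_series_dslope_fslope⟩, dslope_same f 0,
    Eventually.of_forall fun z => ?_⟩
  simpa [hf0] using (sub_smul_dslope f 0 z).symm

lemma exists_succ (hF : HasLeadingTerm F k 0) : ∃ d, HasLeadingTerm F (k + 1) d := by
  obtain ⟨f, hf, hf0, hfF⟩ := hF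
  exact ⟨_, ((zpow k).mul (of_deriv hf hf0)).congr (EventuallyEq.symm hfF)⟩

lemma inv (hF : HasLeadingTerm F k c) (hc : c ≠ 0) :
    HasLeadingTerm (fun z => (F z)⁻¹) (-k) c⁻¹ := by
  obtain ⟨f, hf, rfl, hfF⟩ := hF
  refine ⟨fun z => (f z)⁻¹, hf.inv hc, rfl, hfF.mono fun z hz => ?_⟩
  simp only [hz, mul_inv, zpow_neg]

lemma exists_sub_zpow (hF : HasLeadingTerm F k c) :
    ∃ d, HasLeadingTerm (fun z => F z - c * z ^ k) (k + 1) d := by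
  have := hF.sub ((zpow k).const_mul c)
  rw [mul_one, sub_self] at this
  exact this.exists_succ

lemma tendsto (hF : HasLeadingTerm F k c) :
    Tendsto (fun z => z ^ (-k) * F z) (𝓝[≠] 0) (𝓝 c) := by
  obtain ⟨f, hf, rfl, hfF⟩ := hF
  refine (hf.continuousAt.tendsto.mono_left nhdsWithin_le_nhds).congr' ?_
  filter_upwards [hfF, self_mem_nhdsWithin] with z hz hz0
  rw [hz, ← mul_assoc, ← zpow_add₀ hz0, neg_add_cancel, zpow_zero, one_mul]

lemma unique (hF : HasLeadingTerm F k c) (hF' : HasLeadingTerm F k d) : c = d :=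
  tendsto_nhds_unique hF.tendsto hF'.tendsto

lemma isBigO (hF : HasLeadingTerm F k c) : F =O[𝓝[≠] 0] fun z => z ^ k := by
  refine ((isBigO_refl (fun z : ℂ => z ^ k) (𝓝[≠] 0)).mul (hF.tendsto.isBigO_one ℂ)).congr' ?_
    (by simp)
  filter_upwards [self_mem_nhdsWithin] with z hz0
  rw [← mul_assoc, ← zpow_add₀ hz0, add_neg_cancel, zpow_zero, one_mul]

lemma of_isBigO (hd : ∀ᶠ z in 𝓝[≠] 0, DifferentiableAt ℂ F z)
    (hF : (fun z : ℂ => z ^ (-k) * F z - c) =O[𝓝[≠] 0] fun z : ℂ => z) :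
    HasLeadingTerm F k c := by
  set f : ℂ → ℂ := fun z => z ^ (-k) * F z with hf
  have hlim : Tendsto f (𝓝[≠] 0) (𝓝 c) :=
    tendsto_sub_nhds_zero_iff.1 (hF.trans_tendsto (tendsto_id.mono_left nhdsWithin_le_nhds))
  refine ⟨Function.update f 0 c,
    Complex.analyticAt_of_differentiable_on_punctured_nhds_of_continuousAt ?_
      (continuousAt_update_same.2 hlim), by simp, ?_⟩
  · filter_upwards [hd, self_mem_nhdsWithin] with z hz hz0
    exact ((differentiableAt_zpow.2 (Or.inl hz0)).mul hz).congr_of_eventuallyEq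
      ((isOpen_ne.eventually_mem hz0).mono fun w hw => Function.update_of_ne hw _ _)
  · filter_upwards [self_mem_nhdsWithin] with z hz0
    rw [Function.update_of_ne hz0, hf, ← mul_assoc, ← zpow_add₀ hz0, add_neg_cancel, zpow_zero,
      one_mul]

lemma comp_neg (hF : HasLeadingTerm F k c) :
    HasLeadingTerm (fun z => F (-z)) k ((-1) ^ k * c) := by
  obtain ⟨f, hf, rfl, hfF⟩ := hF
  refine ⟨fun z => (-1) ^ k * f (-z),
    analyticAt_const.mul (hf.comp_of_eq analyticAt_id.neg neg_zero), by simp, ?_⟩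
  filter_upwards [tendsto_neg_nhdsNE_zero.eventually hfF] with z hz
  rw [hz, neg_eq_neg_one_mul z, mul_zpow, mul_comm ((-1 : ℂ) ^ k), mul_assoc]

lemma eq_zero_of_parity (hF : HasLeadingTerm F k c)
    (hneg : ∀ᶠ z in 𝓝[≠] 0, F (-z) = -(-1) ^ k * F z) : c = 0 := by
  have hk : (-1 : ℂ) ^ k ≠ 0 := zpow_ne_zero k (by norm_num)
  have := (hF.comp_neg.congr hneg).unique (hF.const_mul _)
  simpa [hk, self_eq_neg] using this

lemma exists_sub_zpow_of_parity (hF : HasLeadingTerm F k c)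
    (hneg : ∀ᶠ z in 𝓝[≠] 0, F (-z) = (-1) ^ k * F z) :
    ∃ d, HasLeadingTerm (fun z => F z - c * z ^ k) (k + 2) d := by
  obtain ⟨d, hd⟩ := hF.exists_sub_zpow
  obtain rfl : d = 0 := hd.eq_zero_of_parity <| hneg.mono fun z hz => by
    rw [hz, neg_eq_neg_one_mul z, mul_zpow, zpow_add_one₀ (by norm_num)]
    ring
  simpa only [add_assoc, one_add_one_eq_two] using hd.exists_succ

lemma isBigO_zpow_mul_sub (hF : HasLeadingTerm (fun z => F z - z ^ k) (k + 2) d) :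
    (fun z : ℂ => z ^ (-k) * F z - (1 + d * z ^ 2)) =O[𝓝[≠] 0] fun z => z ^ 3 := by
  obtain ⟨e, he⟩ := hF.exists_sub_zpow
  refine ((zpow (-k)).mul he).isBigO.congr' ?_ ?_
  · filter_upwards [self_mem_nhdsWithin] with z hz0
    have hk : z ^ (-k) * z ^ k = 1 := by rw [← zpow_add₀ hz0, neg_add_cancel, zpow_zero]
    rw [zpow_add₀ hz0, zpow_ofNat]
    linear_combination -(1 + d * z ^ 2) * hk
  · rw [show -k + (k + 2 + 1) = (3 : ℕ) by push_cast; ring]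
    simp

end HasLeadingTerm

/-- A substitute for the Weierstrass zeta function: it has a simple pole of residue `1` at the
integers, and it is genuinely `1`-periodic, at the price of taking different mean values in the
upper and the lower half-plane. It is used to remove simple poles at `0`. -/
noncomputable def cotKernel (z : ℂ) : ℂ :=
  2 * Real.pi * Complex.I * (Complex.exp (2 * Real.pi * Complex.I * z) - 1)⁻¹

lemma cexp_two_pi_I_mul_eq_one_iff {z : ℂ} :
    Complex.exp (2 * Real.pi * Complex.I * z) = 1 ↔ ∃ n : ℤ, z = n := by
  rw [Complex.exp_eq_one_iff]
  refine exists_congr fun n => ?_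
  rw [mul_comm, mul_left_inj' Complex.two_pi_I_ne_zero]

lemma cexp_two_pi_I_mul_sub_one_ne_zero {z : ℂ} (hz : ∀ n : ℤ, z ≠ n) :
    Complex.exp (2 * Real.pi * Complex.I * z) - 1 ≠ 0 := fun h0 => by
  obtain ⟨n, hn⟩ := cexp_two_pi_I_mul_eq_one_iff.1 (sub_eq_zero.1 h0)
  exact hz n hn

lemma cexp_two_pi_I_mul_add_intCast (z : ℂ) (n : ℤ) :
    Complex.exp (2 * Real.pi * Complex.I * (z + n)) =
      Complex.exp (2 * Real.pi * Complex.I * z) := by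
  rw [mul_add, Complex.exp_add, cexp_two_pi_I_mul_eq_one_iff.2 ⟨n, rfl⟩, mul_one]

lemma cotKernel_add_intCast (z : ℂ) (n : ℤ) : cotKernel (z + n) = cotKernel z := by
  rw [cotKernel, cexp_two_pi_I_mul_add_intCast, cotKernel]

lemma differentiableAt_cotKernel {z : ℂ} (hz : ∀ n : ℤ, z ≠ n) :
    DifferentiableAt ℂ cotKernel z := by
  have hne := cexp_two_pi_I_mul_sub_one_ne_zero hz
  unfold cotKernel
  fun_prop (disch := assumption)

lemma ne_intCast_of_im_ne_zero {z : ℂ} (hz : z.im ≠ 0) (n : ℤ) : z ≠ n := by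
  rintro rfl
  exact hz (Complex.intCast_im n)

lemma hasLeadingTerm_cotKernel : HasLeadingTerm cotKernel (-1) 1 := by
  have hderiv : HasDerivAt (fun z : ℂ => Complex.exp (2 * Real.pi * Complex.I * z) - 1)
      (2 * Real.pi * Complex.I) 0 := by
    simpa using (((hasDerivAt_id (0 : ℂ)).const_mul (2 * Real.pi * Complex.I)).cexp).sub_const 1
  have hexp := HasLeadingTerm.of_deriv
    (f := fun z : ℂ => Complex.exp (2 * Real.pi * Complex.I * z) - 1) (by fun_prop) (by simp)
  rw [hderiv.deriv] at hexp
  have := (hexp.inv Complex.two_pi_I_ne_zero).const_mul (2 * Real.pi * Complex.I)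
  rwa [mul_inv_cancel₀ Complex.two_pi_I_ne_zero] at this

lemma cotKernel_neg {z : ℂ} (hz : z.im ≠ 0) :
    cotKernel (-z) = -(2 * Real.pi * Complex.I) - cotKernel z := by
  have hne := cexp_two_pi_I_mul_sub_one_ne_zero (ne_intCast_of_im_ne_zero hz)
  have hne' : 1 - Complex.exp (2 * Real.pi * Complex.I * z) ≠ 0 := by
    rwa [← neg_sub, neg_ne_zero]
  have he := Complex.exp_ne_zero (2 * Real.pi * Complex.I * z)
  rw [cotKernel, cotKernel, mul_neg, Complex.exp_neg]
  field_simp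
  ring

lemma continuous_cotKernel_line {z : ℂ} (hz : z.im ≠ 0) :
    Continuous fun t : ℝ => cotKernel (z + t) :=
  continuous_iff_continuousAt.2 fun t => ContinuousAt.comp (g := cotKernel)
    (differentiableAt_cotKernel (ne_intCast_of_im_ne_zero (by simpa using hz))).continuousAt
    (by fun_prop)

/-- `log (1 - exp (2πiz))` is a periodic primitive of `cotKernel + 2πi` in the upper
half-plane. -/
lemma integral_cotKernel_of_im_pos {z : ℂ} (hz : 0 < z.im) :
    ∫ t : ℝ in (0 : ℝ)..1, cotKernel (z + t) = -(2 * Real.pi * Complex.I) := by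
  set q : ℂ → ℂ := fun w => Complex.exp (2 * Real.pi * Complex.I * w) with hq
  have hslit {w : ℂ} (hw : 0 < w.im) : 1 - q w ∈ Complex.slitPlane := by
    rw [sub_eq_add_neg]
    refine Complex.mem_slitPlane_of_norm_lt_one ?_
    rw [norm_neg, hq, Complex.norm_exp, Real.exp_lt_one_iff]
    simpa using by positivity
  have hderiv (t : ℝ) : HasDerivAt (fun t : ℝ => Complex.log (1 - q (z + t)))
      (cotKernel (z + t) + 2 * Real.pi * Complex.I) t := by
    have ht : 0 < (z + t).im := by simpa using hz
    have hne := Complex.slitPlane_ne_zero (hslit ht)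
    have hlog := ((((hasDerivAt_id (z + t)).const_mul (2 * Real.pi * Complex.I)).cexp).const_sub 1
      ).clog (hslit ht)
    refine ((hlog.comp_const_add z (t : ℂ)).comp_ofReal).congr_deriv ?_
    change -(q (z + t) * (2 * Real.pi * Complex.I * 1)) / (1 - q (z + t)) =
      2 * Real.pi * Complex.I * (q (z + t) - 1)⁻¹ + 2 * Real.pi * Complex.I
    generalize q (z + t) = x at hne
    have hne' : x - 1 ≠ 0 := by rwa [← neg_sub, neg_ne_zero]
    field_simp
    ring
  have hftc := intervalIntegral.integral_eq_sub_of_hasDerivAt (a := 0) (b := 1)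
    (fun t _ => hderiv t)
    (((continuous_cotKernel_line hz.ne').add continuous_const).intervalIntegrable _ _)
  have hper : q (z + (1 : ℝ)) = q (z + (0 : ℝ)) := by
    simpa using cexp_two_pi_I_mul_add_intCast z 1
  rw [hper, sub_self, intervalIntegral.integral_add
    ((continuous_cotKernel_line hz.ne').intervalIntegrable _ _) intervalIntegrable_const] at hftc
  simpa using eq_neg_of_add_eq_zero_left hftc

lemma integral_cotKernel_of_im_neg {z : ℂ} (hz : z.im < 0) :
    ∫ t : ℝ in (0 : ℝ)..1, cotKernel (z + t) = 0 := by
  have hflip (t : ℝ) : cotKernel (z + t) =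
      -(2 * Real.pi * Complex.I) - cotKernel (-z - 1 + (1 - t : ℝ)) := by
    rw [← cotKernel_neg (by simpa using hz.ne)]
    congr 1
    push_cast
    ring
  have hz' : 0 < (-z - 1).im := by simpa using hz
  simp only [hflip]
  rw [intervalIntegral.integral_comp_sub_left
      (fun t : ℝ => -(2 * Real.pi * Complex.I) - cotKernel (-z - 1 + t)), sub_self, sub_zero,
    intervalIntegral.integral_sub intervalIntegrable_const
      ((continuous_cotKernel_line hz'.ne').intervalIntegrable _ _),
    integral_cotKernel_of_im_pos hz']
  simp

section Lattice

variable {τ : UpperHalfPlane} {z l : ℂ}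

lemma mem_Λ : z ∈ Λ τ ↔ ∃ m n : ℤ, (m : ℂ) + n * (τ : ℂ) = z := by
  simp [Λ, PeriodPair.mem_lattice, periods]

lemma intCast_mem_Λ (m : ℤ) : (m : ℂ) ∈ Λ τ := mem_Λ.2 ⟨m, 0, by simp⟩

lemma intCast_mul_τ_mem_Λ (n : ℤ) : n * (τ : ℂ) ∈ Λ τ := mem_Λ.2 ⟨0, n, by simp⟩

lemma τ_mem_Λ : (τ : ℂ) ∈ Λ τ := by simpa using intCast_mul_τ_mem_Λ (τ := τ) 1

lemma exists_im_eq_of_mem_Λ (hz : z ∈ Λ τ) : ∃ n : ℤ, z.im = n * τ.im := by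
  obtain ⟨m, n, rfl⟩ := mem_Λ.1 hz
  exact ⟨n, by simp⟩

lemma eventually_notMem_Λ (z : ℂ) : ∀ᶠ w in 𝓝[≠] z, w ∉ Λ τ := by
  filter_upwards [nhdsWithin_le_nhds ((periods τ).compl_lattice_sdiff_singleton_mem_nhds z),
    self_mem_nhdsWithin] with w hw hwz hwΛ
  exact hw ⟨hwΛ, hwz⟩

@[simp] lemma γ_im (t : ℝ) : (γ τ t).im = τ.im / 2 := by simp [γ]

lemma exists_eq_γ (hz : z.im = τ.im / 2) : ∃ t, z = γ τ t :=
  ⟨(z - τ / 2).re, Complex.ext (by simp [γ]) (by simp [hz])⟩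

lemma mem_domain_iff : z ∈ domain τ ↔ z ∉ Λ τ ∧ ∀ n : ℤ, z.im ≠ (n + 1 / 2) * τ.im := by
  refine and_congr_right fun _ => ⟨fun hz n hn => ?_, fun hz t _ ht => ?_⟩
  · obtain ⟨t, ht⟩ := exists_eq_γ (τ := τ) (z := z - n * τ) (by
      simp only [Complex.sub_im, hn, Complex.mul_im, Complex.intCast_re, Complex.intCast_im,
        zero_mul, add_zero, UpperHalfPlane.coe_im]
      ring)
    refine hz (Int.fract t) ⟨Int.fract_nonneg t, (Int.fract_lt_one t).le⟩
      (mem_Λ.2 ⟨⌊t⌋, n, ?_⟩)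
    have hfract : ((⌊t⌋ : ℝ) : ℂ) + (Int.fract t : ℝ) = t := by
      rw [← Complex.ofReal_add, Int.floor_add_fract]
    simp only [γ, Complex.ofReal_intCast] at ht hfract ⊢
    linear_combination hfract - ht
  · obtain ⟨n, hn⟩ := exists_im_eq_of_mem_Λ ht
    refine hz n ?_
    rw [Complex.sub_im, γ_im] at hn
    linear_combination hn

lemma add_mem_domain (hz : z ∈ domain τ) (hl : l ∈ Λ τ) : z + l ∈ domain τ := by
  refine ⟨fun h => hz.1 (by simpa using sub_mem h hl), fun t ht h => hz.2 t ht ?_⟩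
  simpa [sub_right_comm, add_sub_right_comm] using sub_mem h hl

lemma neg_mem_domain (hz : z ∈ domain τ) : -z ∈ domain τ := by
  rw [mem_domain_iff] at hz ⊢
  refine ⟨fun h => hz.1 (by simpa using neg_mem h), fun n hn => hz.2 (-n - 1) ?_⟩
  rw [Complex.neg_im] at hn
  push_cast
  linear_combination -hn

/-- The open strip between the contours `γ - τ` and `γ`; it contains a representative of every
point of the torus off `γ`. -/
def strip (τ : UpperHalfPlane) : Set ℂ := Complex.im ⁻¹' Set.Ioo (-(τ.im / 2)) (τ.im / 2)

lemma isOpen_strip : IsOpen (strip τ) := isOpen_Ioo.preimage Complex.continuous_im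

lemma zero_mem_strip : (0 : ℂ) ∈ strip τ := by simp [strip, τ.im_pos]

lemma neg_half_im_lt_half_im (τ : UpperHalfPlane) : -(τ.im / 2) < τ.im / 2 := by
  linarith [τ.im_pos]

lemma closure_strip : closure (strip τ) = Complex.im ⁻¹' Set.Icc (-(τ.im / 2)) (τ.im / 2) :=
  closure_im_preimage_Ioo (neg_half_im_lt_half_im τ)

lemma γ_mem_closure_strip (t : ℝ) : γ τ t ∈ closure (strip τ) := by
  simp [closure_strip, (neg_half_im_lt_half_im τ).le]

lemma γ_sub_τ_im (t : ℝ) : (γ τ t - τ).im = -(τ.im / 2) := by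
  simp only [Complex.sub_im, γ_im, UpperHalfPlane.coe_im]
  ring

lemma γ_sub_mem_closure_strip (t : ℝ) : γ τ t - τ ∈ closure (strip τ) := by
  simp [closure_strip, γ_sub_τ_im, (neg_half_im_lt_half_im τ).le, -Complex.sub_im]

lemma eq_intCast_of_mem_strip (hz : z ∈ strip τ) (hΛ : z ∈ Λ τ) : ∃ m : ℤ, z = m := by
  obtain ⟨m, n, rfl⟩ := mem_Λ.1 hΛ
  obtain ⟨hlow, hhigh⟩ : -(τ.im / 2) < n * τ.im ∧ n * τ.im < τ.im / 2 := by
    simpa [strip] using hz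
  have hn_lt : (n : ℝ) < 1 := by nlinarith [τ.im_pos]
  have hn_gt : (-1 : ℝ) < n := by nlinarith [τ.im_pos]
  obtain rfl : n = 0 := by
    norm_cast at hn_lt hn_gt
    omega
  exact ⟨m, by simp⟩

lemma strip_diff_subset_domain : strip τ \ Λ τ ⊆ domain τ := fun z hz => by
  refine mem_domain_iff.2 ⟨hz.2, fun n hn => ?_⟩
  obtain ⟨hlow, hhigh⟩ : -(τ.im / 2) < z.im ∧ z.im < τ.im / 2 := hz.1
  have hn_lt : (n : ℝ) < 0 := by nlinarith [τ.im_pos]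
  have hn_gt : (-1 : ℝ) < n := by nlinarith [τ.im_pos]
  norm_cast at hn_lt hn_gt
  omega

lemma exists_add_mem_strip (hz : z ∈ domain τ) : ∃ l ∈ Λ τ, z + l ∈ strip τ \ Λ τ := by
  have hτ := τ.im_pos
  set n := round (z.im / τ.im)
  have hl : ((-n : ℤ) : ℂ) * τ ∈ Λ τ := intCast_mul_τ_mem_Λ _
  have hz' := mem_domain_iff.1 (add_mem_domain hz hl)
  have him : (z + (-n : ℤ) * τ).im = (z.im / τ.im - n) * τ.im := by
    rw [sub_mul, div_mul_cancel₀ _ hτ.ne']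
    simp [sub_eq_add_neg]
  obtain ⟨hlow, hhigh⟩ := abs_le.1 (abs_sub_round (z.im / τ.im))
  refine ⟨_, hl, ⟨lt_of_le_of_ne ?_ fun h => hz'.2 (-1) ?_, lt_of_le_of_ne ?_ fun h => hz'.2 0 ?_⟩,
    hz'.1⟩
  · rw [him]; nlinarith
  · rw [← h]; push_cast; ring
  · rw [him]; nlinarith
  · rw [h]; push_cast; ring

lemma eventually_mem_strip_diff : ∀ᶠ z in 𝓝[≠] (0 : ℂ), z ∈ strip τ \ Λ τ :=
  eventually_mem_diff isOpen_strip eventually_notMem_Λ zero_mem_strip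

lemma eventually_mem_domain : ∀ᶠ z in 𝓝[≠] (0 : ℂ), z ∈ domain τ :=
  eventually_mem_strip_diff.mono fun _ hz => strip_diff_subset_domain hz

lemma mem_domain_of_im_mem_Ioo (hz : z.im ∈ Set.Ioo 0 τ.im) (hz' : z.im ≠ τ.im / 2) :
    z ∈ domain τ := by
  have hτ := τ.im_pos
  refine mem_domain_iff.2 ⟨fun hΛ => ?_, fun n hn => ?_⟩
  · obtain ⟨n, hn⟩ := exists_im_eq_of_mem_Λ hΛ
    have hn_gt : (0 : ℝ) < n := by nlinarith [hz.1]
    have hn_lt : (n : ℝ) < 1 := by nlinarith [hz.2]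
    norm_cast at hn_gt hn_lt
    omega
  · have hn_gt : (-1 : ℝ) < n := by nlinarith [hz.1]
    have hn_lt : (n : ℝ) < 1 := by nlinarith [hz.2]
    obtain rfl : n = 0 := by
      norm_cast at hn_gt hn_lt
      omega
    exact hz' (by rw [hn]; push_cast; ring)

lemma eventually_mem_domain_of_im_ne (t : ℝ) :
    ∀ᶠ z in 𝓝 (γ τ t), z.im ≠ (γ τ t).im → z ∈ domain τ := by
  have hmem : (γ τ t).im ∈ Set.Ioo 0 τ.im := by
    rw [γ_im]
    exact ⟨half_pos τ.im_pos, half_lt_self τ.im_pos⟩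
  filter_upwards [Complex.continuous_im.continuousAt.eventually_mem (isOpen_Ioo.mem_nhds hmem)]
    with z hz hne
  exact mem_domain_of_im_mem_Ioo hz (by simpa using hne)

lemma γ_notMem_Λ (t : ℝ) : γ τ t ∉ Λ τ := fun h => by
  obtain ⟨n, hn⟩ := exists_im_eq_of_mem_Λ h
  rw [γ_im] at hn
  have h2 : ((2 * n : ℤ) : ℝ) = (1 : ℤ) := by
    push_cast
    exact mul_right_cancel₀ τ.im_pos.ne' (by linear_combination -2 * hn)
  have := Int.cast_injective h2
  omega

end Lattice

section

/-- `F` is a function on the torus, analytic off the contour and the origin, with limits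
`P` and `M` on the contour from the left (above) and from the right (below). As in
`IsRHPSolution`, its values outside `domain τ` play no role. -/
structure SectionallyAnalytic (τ : UpperHalfPlane) (F : ℂ → ℂ) (P M : ℝ → ℂ) : Prop where
  periodic : ∀ z ∈ domain τ, ∀ l ∈ Λ τ, F (z + l) = F z
  analytic : AnalyticOnNhd ℂ F (domain τ)
  above : ∀ t : ℝ, Tendsto F (𝓝[{z | (γ τ t).im < z.im}] (γ τ t)) (𝓝 (P t))
  below : ∀ t : ℝ, Tendsto F (𝓝[{z | z.im < (γ τ t).im}] (γ τ t)) (𝓝 (M t))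

/-- `f` is an elliptic function whose only poles are the lattice points. -/
structure IsElliptic (τ : UpperHalfPlane) (f : ℂ → ℂ) : Prop where
  periodic : ∀ z, ∀ l ∈ Λ τ, f (z + l) = f z
  analytic : ∀ z ∉ Λ τ, AnalyticAt ℂ f z

variable {τ : UpperHalfPlane} {F G : ℂ → ℂ} {P M P' M' : ℝ → ℂ}

lemma IsElliptic.sectionallyAnalytic {f : ℂ → ℂ} (hf : IsElliptic τ f) :
    SectionallyAnalytic τ f (fun t => f (γ τ t)) (fun t => f (γ τ t)) where
  periodic z _ := hf.periodic z
  analytic z hz := hf.analytic z hz.1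
  above t := (hf.analytic _ (γ_notMem_Λ t)).continuousAt.tendsto.mono_left nhdsWithin_le_nhds
  below t := (hf.analytic _ (γ_notMem_Λ t)).continuousAt.tendsto.mono_left nhdsWithin_le_nhds

lemma IsElliptic.continuous_γ {f : ℂ → ℂ} (hf : IsElliptic τ f) :
    Continuous fun t => f (γ τ t) :=
  continuous_iff_continuousAt.2 fun t => ContinuousAt.comp (g := f)
    (hf.analytic _ (γ_notMem_Λ t)).continuousAt (by unfold γ; fun_prop)

namespace SectionallyAnalytic

lemma mul (hF : SectionallyAnalytic τ F P M) (hG : SectionallyAnalytic τ G P' M') :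
    SectionallyAnalytic τ (fun z => F z * G z) (fun t => P t * P' t) (fun t => M t * M' t) where
  periodic z hz l hl := by rw [hF.periodic z hz l hl, hG.periodic z hz l hl]
  analytic := hF.analytic.mul hG.analytic
  above t := (hF.above t).mul (hG.above t)
  below t := (hF.below t).mul (hG.below t)

lemma sub (hF : SectionallyAnalytic τ F P M) (hG : SectionallyAnalytic τ G P' M') :
    SectionallyAnalytic τ (fun z => F z - G z) (fun t => P t - P' t) (fun t => M t - M' t) where
  periodic z hz l hl := by rw [hF.periodic z hz l hl, hG.periodic z hz l hl]
  analytic := hF.analytic.sub hG.analytic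
  above t := (hF.above t).sub (hG.above t)
  below t := (hF.below t).sub (hG.below t)

lemma const_mul (hF : SectionallyAnalytic τ F P M) (c : ℂ) :
    SectionallyAnalytic τ (fun z => c * F z) (fun t => c * P t) (fun t => c * M t) where
  periodic z hz l hl := by rw [hF.periodic z hz l hl]
  analytic := analyticOnNhd_const.mul hF.analytic
  above t := (hF.above t).const_mul c
  below t := (hF.below t).const_mul c

lemma tendsto_comp_neg (hF : SectionallyAnalytic τ F P M) {s s' : Set ℂ} {t : ℝ} {y : ℂ}
    (hs : ∀ z ∈ s, z.im ≠ (γ τ t).im) (hss' : Set.MapsTo (fun z : ℂ => -z + τ) s s')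
    (hy : Tendsto F (𝓝[s'] γ τ (-t)) (𝓝 y)) : Tendsto (fun z => F (-z)) (𝓝[s] γ τ t) (𝓝 y) := by
  have hreflect : Tendsto (fun z : ℂ => -z + τ) (𝓝[s] γ τ t) (𝓝[s'] γ τ (-t)) := by
    have hγ : -γ τ t + τ = γ τ (-t) := by
      simp only [γ, Complex.ofReal_neg]
      ring
    exact hγ ▸ (Continuous.continuousWithinAt (by fun_prop)).tendsto_nhdsWithin hss'
  refine (hy.comp hreflect).congr' ?_
  filter_upwards [eventually_nhdsWithin_of_eventually_nhds (eventually_mem_domain_of_im_ne t),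
    self_mem_nhdsWithin] with z hz hzs
  exact hF.periodic _ (neg_mem_domain (hz (hs z hzs))) _ τ_mem_Λ

lemma comp_neg (hF : SectionallyAnalytic τ F P M) :
    SectionallyAnalytic τ (fun z => F (-z)) (fun t => M (-t)) (fun t => P (-t)) where
  periodic z hz l hl := by
    rw [neg_add, hF.periodic _ (neg_mem_domain hz) _ (neg_mem hl)]
  analytic z hz := (hF.analytic _ (neg_mem_domain hz)).comp_of_eq analyticAt_id.neg rfl
  above t := hF.tendsto_comp_neg (fun _ hz => ne_of_gt hz)
    (fun z hz => by
      simp only [Set.mem_ofPred_eq, γ_im, Complex.add_im, Complex.neg_im,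
        UpperHalfPlane.coe_im] at hz ⊢
      linarith) (hF.below (-t))
  below t := hF.tendsto_comp_neg (fun _ hz => ne_of_lt hz)
    (fun z hz => by
      simp only [Set.mem_ofPred_eq, γ_im, Complex.add_im, Complex.neg_im,
        UpperHalfPlane.coe_im] at hz ⊢
      linarith) (hF.above (-t))

end SectionallyAnalytic

end

section

variable {τ : UpperHalfPlane} {F : ℂ → ℂ} {P M : ℝ → ℂ} {c : ℂ}

/-- The function `F`, with a simple pole of residue `c` at the integers removed, extended
continuously from the open strip between `γ - τ` and `γ` to the closed one. -/
noncomputable def removePole (τ : UpperHalfPlane) (F : ℂ → ℂ) (c : ℂ) : ℂ → ℂ :=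
  extendFrom (strip τ \ Λ τ) fun z => F z - c * cotKernel z

lemma differentiableAt_cotKernel_of_notMem_Λ {z : ℂ} (hz : z ∉ Λ τ) :
    DifferentiableAt ℂ cotKernel z :=
  differentiableAt_cotKernel fun n hn => hz (hn ▸ intCast_mem_Λ n)

lemma tendsto_cotKernel {z : ℂ} (hz : z ∉ Λ τ) (s : Set ℂ) :
    Tendsto cotKernel (𝓝[s] z) (𝓝 (cotKernel z)) :=
  (differentiableAt_cotKernel_of_notMem_Λ hz).continuousAt.tendsto.mono_left nhdsWithin_le_nhds

lemma add_intCast_mem_strip {z : ℂ} (m : ℤ) : z + m ∈ strip τ ↔ z ∈ strip τ := by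
  simp [strip]

namespace SectionallyAnalytic

lemma tendsto_sub_cotKernel_γ (hF : SectionallyAnalytic τ F P M) (c : ℂ) (t : ℝ) :
    Tendsto (fun z => F z - c * cotKernel z) (𝓝[strip τ \ Λ τ] γ τ t)
      (𝓝 (M t - c * cotKernel (γ τ t))) :=
  ((hF.below t).mono_left (nhdsWithin_mono _ fun z hz => by simpa using hz.1.2)).sub
    ((tendsto_cotKernel (γ_notMem_Λ t) _).const_mul c)

lemma tendsto_sub_cotKernel_γ_sub (hF : SectionallyAnalytic τ F P M) (c : ℂ) (t : ℝ) :
    Tendsto (fun z => F z - c * cotKernel z) (𝓝[strip τ \ Λ τ] (γ τ t - τ))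
      (𝓝 (P t - c * cotKernel (γ τ t - τ))) := by
  have hshift : Tendsto (fun z : ℂ => z + τ) (𝓝[strip τ \ Λ τ] (γ τ t - τ))
      (𝓝[{z | (γ τ t).im < z.im}] γ τ t) := by
    have hmaps : Set.MapsTo (fun z : ℂ => z + τ) (strip τ \ Λ τ) {z | (γ τ t).im < z.im} :=
      fun z hz => by
        have hlow := hz.1.1
        simp only [Set.mem_ofPred_eq, γ_im, Complex.add_im, UpperHalfPlane.coe_im]
        linarith
    simpa only [sub_add_cancel] using
      (Continuous.continuousWithinAt (x := γ τ t - τ) (by fun_prop)).tendsto_nhdsWithin hmaps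
  have hP : Tendsto F (𝓝[strip τ \ Λ τ] (γ τ t - τ)) (𝓝 (P t)) :=
    ((hF.above t).comp hshift).congr' <| eventually_mem_nhdsWithin.mono fun z hz =>
      hF.periodic z (strip_diff_subset_domain hz) _ τ_mem_Λ
  exact hP.sub ((tendsto_cotKernel (fun h => γ_notMem_Λ t
    (by simpa using add_mem h (τ_mem_Λ (τ := τ)))) _).const_mul c)

lemma tendsto_sub_cotKernel_add_intCast (hF : SectionallyAnalytic τ F P M) {z y : ℂ}
    (hy : Tendsto (fun z => F z - c * cotKernel z) (𝓝[strip τ \ Λ τ] z) (𝓝 y)) (m : ℤ) :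
    Tendsto (fun z => F z - c * cotKernel z) (𝓝[strip τ \ Λ τ] (z + m)) (𝓝 y) := by
  have hmem {w : ℂ} (hw : w ∈ strip τ \ Λ τ) : w + (-m : ℤ) ∈ strip τ \ Λ τ :=
    ⟨(add_intCast_mem_strip _).2 hw.1,
      (add_mem_domain (strip_diff_subset_domain hw) (intCast_mem_Λ _)).1⟩
  have hshift : Tendsto (fun w : ℂ => w + (-m : ℤ)) (𝓝[strip τ \ Λ τ] (z + m))
      (𝓝[strip τ \ Λ τ] z) := by
    simpa using (Continuous.continuousWithinAt (x := z + m) (by fun_prop)).tendsto_nhdsWithin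
      fun w hw => hmem hw
  refine (hy.comp hshift).congr' (eventually_mem_nhdsWithin.mono fun w hw => ?_)
  simp only [Function.comp_apply, cotKernel_add_intCast,
    hF.periodic w (strip_diff_subset_domain hw) _ (intCast_mem_Λ _)]

lemma exists_tendsto_sub_cotKernel_zero (h0 : HasLeadingTerm F (-1) c) :
    ∃ y, Tendsto (fun z => F z - c * cotKernel z) (𝓝[strip τ \ Λ τ] 0) (𝓝 y) := by
  have hsub := h0.sub (hasLeadingTerm_cotKernel.const_mul c)
  rw [mul_one, sub_self] at hsub
  obtain ⟨y, hy⟩ := hsub.exists_succ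
  refine ⟨y, (hy.tendsto.mono_left (nhdsWithin_mono _ ?_)).congr fun z => by simp⟩
  rintro z hz rfl
  exact hz.2 (zero_mem _)

lemma exists_tendsto_sub_cotKernel (hF : SectionallyAnalytic τ F P M)
    (h0 : HasLeadingTerm F (-1) c) {z : ℂ} (hz : z ∈ closure (strip τ)) :
    ∃ y, Tendsto (fun z => F z - c * cotKernel z) (𝓝[strip τ \ Λ τ] z) (𝓝 y) := by
  rw [closure_strip] at hz
  rcases hz.2.eq_or_lt with htop | htop
  · obtain ⟨t, rfl⟩ := exists_eq_γ htop
    exact ⟨_, hF.tendsto_sub_cotKernel_γ c t⟩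
  rcases hz.1.eq_or_lt with hbot | hbot
  · obtain ⟨t, ht⟩ := exists_eq_γ (τ := τ) (z := z + τ) (by
      rw [Complex.add_im, ← hbot, UpperHalfPlane.coe_im]
      ring)
    obtain rfl := eq_sub_of_add_eq ht
    exact ⟨_, hF.tendsto_sub_cotKernel_γ_sub c t⟩
  by_cases hΛ : z ∈ Λ τ
  · obtain ⟨m, rfl⟩ := eq_intCast_of_mem_strip ⟨hbot, htop⟩ hΛ
    obtain ⟨y, hy⟩ := exists_tendsto_sub_cotKernel_zero h0
    exact ⟨y, by simpa using hF.tendsto_sub_cotKernel_add_intCast hy m⟩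
  · exact ⟨_, ((hF.analytic z (strip_diff_subset_domain ⟨⟨hbot, htop⟩, hΛ⟩)).continuousAt.tendsto
      |>.mono_left nhdsWithin_le_nhds).sub ((tendsto_cotKernel hΛ _).const_mul c)⟩

lemma removePole_γ (hF : SectionallyAnalytic τ F P M) (c : ℂ) (t : ℝ) :
    removePole τ F c (γ τ t) = M t - c * cotKernel (γ τ t) :=
  extendFrom_diff_eq isOpen_strip eventually_notMem_Λ (γ_mem_closure_strip t)
    (hF.tendsto_sub_cotKernel_γ c t)

lemma removePole_γ_sub (hF : SectionallyAnalytic τ F P M) (c : ℂ) (t : ℝ) :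
    removePole τ F c (γ τ t - τ) = P t - c * cotKernel (γ τ t - τ) :=
  extendFrom_diff_eq isOpen_strip eventually_notMem_Λ (γ_sub_mem_closure_strip t)
    (hF.tendsto_sub_cotKernel_γ_sub c t)

lemma periodicOnStrip_removePole (hF : SectionallyAnalytic τ F P M)
    (h0 : HasLeadingTerm F (-1) c) :
    PeriodicOnStrip (-(τ.im / 2)) (τ.im / 2) (removePole τ F c) where
  diffContOnCl := diffContOnCl_extendFrom isOpen_strip eventually_notMem_Λ
    (fun z hz => (hF.analytic z (strip_diff_subset_domain hz)).differentiableAt.sub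
      ((differentiableAt_cotKernel_of_notMem_Λ hz.2).const_mul c))
    fun _ => hF.exists_tendsto_sub_cotKernel h0
  add_one z hz := by
    have hz' : z ∈ closure (strip τ) := by rwa [closure_strip]
    obtain ⟨y, hy⟩ := hF.exists_tendsto_sub_cotKernel h0 hz'
    rw [removePole, extendFrom_diff_eq isOpen_strip eventually_notMem_Λ hz' hy]
    refine extendFrom_diff_eq isOpen_strip eventually_notMem_Λ ?_
      (by simpa using hF.tendsto_sub_cotKernel_add_intCast hy 1)
    simpa [closure_strip] using hz

/-- The residue theorem on the torus cut along `γ`: the residue is carried by `c * cotKernel`, whose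
mean values over `γ - τ` and `γ` differ by `2πi c`. -/
theorem integral_above_sub_below (hF : SectionallyAnalytic τ F P M) (h0 : HasLeadingTerm F (-1) c) :
    ∫ t in (0 : ℝ)..1, (P t - M t) = 2 * Real.pi * Complex.I * c := by
  have hγ (t : ℝ) : γ τ 0 + t = γ τ t := by simp [γ]
  have hγ' (t : ℝ) : γ τ 0 - τ + t = γ τ t - τ := by
    rw [← hγ t, sub_add_eq_add_sub]
  have hG := hF.periodicOnStrip_removePole h0
  have hab := neg_half_im_lt_half_im τ
  have htop : (γ τ 0).im ∈ Set.Icc (-(τ.im / 2)) (τ.im / 2) := by simp [hab.le]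
  have hbot : (γ τ 0 - τ).im ∈ Set.Icc (-(τ.im / 2)) (τ.im / 2) := by
    simp [γ_sub_τ_im, hab.le, -Complex.sub_im]
  have hpos : 0 < (γ τ 0).im := by simp [τ.im_pos]
  have hneg : (γ τ 0 - τ).im < 0 := by simp [γ_sub_τ_im, τ.im_pos, -Complex.sub_im]
  have hP (t : ℝ) :
      P t = removePole τ F c (γ τ 0 - τ + t) + c * cotKernel (γ τ 0 - τ + t) := by
    rw [hγ', hF.removePole_γ_sub, sub_add_cancel]
  have hM (t : ℝ) : M t = removePole τ F c (γ τ 0 + t) + c * cotKernel (γ τ 0 + t) := by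
    rw [hγ, hF.removePole_γ, sub_add_cancel]
  have hPint := (hG.continuous_line hab hbot).intervalIntegrable (μ := MeasureTheory.volume) 0 1
  have hMint := (hG.continuous_line hab htop).intervalIntegrable (μ := MeasureTheory.volume) 0 1
  have hpos' := ((continuous_cotKernel_line hpos.ne').const_mul c).intervalIntegrable
    (μ := MeasureTheory.volume) 0 1
  have hneg' := ((continuous_cotKernel_line hneg.ne).const_mul c).intervalIntegrable
    (μ := MeasureTheory.volume) 0 1
  simp only [hP, hM]
  rw [intervalIntegral.integral_sub (hPint.add hneg') (hMint.add hpos'),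
    intervalIntegral.integral_add hPint hneg', intervalIntegral.integral_add hMint hpos',
    intervalIntegral.integral_const_mul, intervalIntegral.integral_const_mul,
    integral_cotKernel_of_im_pos hpos, integral_cotKernel_of_im_neg hneg,
    hG.integral_eq hab htop hbot]
  ring

theorem eq_of_hasLeadingTerm_zero (hF : SectionallyAnalytic τ F P P) (h0 : HasLeadingTerm F 0 c)
    {z : ℂ} (hz : z ∈ domain τ) : F z = c := by
  have hG := hF.periodicOnStrip_removePole (h0.of_lt (l := -1) (by norm_num))
  have hGτ (w : ℂ) (hw : w.im = -(τ.im / 2)) :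
      removePole τ F 0 (w + τ) = removePole τ F 0 w := by
    obtain ⟨t, ht⟩ := exists_eq_γ (τ := τ) (z := w + τ) (by
      rw [Complex.add_im, hw, UpperHalfPlane.coe_im]
      ring)
    rw [ht, eq_sub_of_add_eq ht, hF.removePole_γ, hF.removePole_γ_sub, zero_mul, zero_mul]
  have hstrip {w : ℂ} (hw : w ∈ strip τ \ Λ τ) : removePole τ F 0 w = F w := by
    refine extendFrom_diff_eq isOpen_strip eventually_notMem_Λ (subset_closure hw.1) ?_
    simpa using (hF.analytic w (strip_diff_subset_domain hw)).continuousAt.tendsto.mono_left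
      nhdsWithin_le_nhds
  have hzero : removePole τ F 0 0 = c := by
    refine extendFrom_diff_eq isOpen_strip eventually_notMem_Λ (subset_closure zero_mem_strip) ?_
    refine (h0.tendsto.mono_left (nhdsWithin_mono _ ?_)).congr fun z => by simp
    rintro w hw rfl
    exact hw.2 (zero_mem _)
  obtain ⟨l, hl, hzl⟩ := exists_add_mem_strip hz
  rw [← hF.periodic z hz l hl, ← hstrip hzl, ← hzero]
  have hIcc {w : ℂ} (hw : w ∈ strip τ) := Set.Ioo_subset_Icc_self hw
  refine hG.eq_of_add_period (neg_half_im_lt_half_im τ) (w := τ) ?_ hGτ (hIcc hzl.1)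
    (hIcc zero_mem_strip)
  rw [UpperHalfPlane.coe_im]
  ring

end SectionallyAnalytic

end

section

variable {τ : UpperHalfPlane} {F f : ℂ → ℂ} {P M : ℝ → ℂ} {c : ℂ} {n : ℕ}

lemma SectionallyAnalytic.eq_of_eqOn_domain (hF : SectionallyAnalytic τ F P M)
    (hf : IsElliptic τ f) (hFf : Set.EqOn F f (domain τ)) (t : ℝ) : P t = f (γ τ t) := by
  have hne : (𝓝[{z | (γ τ t).im < z.im}] γ τ t).NeBot := by
    rw [← mem_closure_iff_nhdsWithin_neBot, Complex.closure_setOfPred_lt_im]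
    exact le_refl (γ τ t).im
  refine tendsto_nhds_unique_of_eventuallyEq (hF.above t) (hf.sectionallyAnalytic.above t) ?_
  filter_upwards [eventually_nhdsWithin_of_eventually_nhds (eventually_mem_domain_of_im_ne t),
    self_mem_nhdsWithin] with z hz hzt
  exact hFf (hz (ne_of_gt hzt))

/-- An odd function on the torus has no constant term, and its simple pole is excluded by the
residue theorem. -/
lemma SectionallyAnalytic.eq_zero_of_odd (hF : SectionallyAnalytic τ F P P)
    (h0 : HasLeadingTerm F (-2) c) (hodd : ∀ z ∈ domain τ, F (-z) = -F z) {z : ℂ}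
    (hz : z ∈ domain τ) : F z = 0 := by
  have hodd' : ∀ᶠ z in 𝓝[≠] 0, F (-z) = -F z := eventually_mem_domain.mono hodd
  obtain rfl := h0.eq_zero_of_parity (by simpa [even_two] using hodd')
  obtain ⟨d, hd⟩ := h0.exists_succ
  have hres := hF.integral_above_sub_below hd
  simp only [sub_self, intervalIntegral.integral_zero] at hres
  obtain rfl := (mul_eq_zero.1 hres.symm).resolve_left Complex.two_pi_I_ne_zero
  obtain ⟨e, he⟩ := hd.exists_succ
  obtain rfl := he.eq_zero_of_parity (by simpa using hodd')
  exact hF.eq_of_hasLeadingTerm_zero he hz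

lemma isElliptic_wp : IsElliptic τ (wp τ) where
  periodic z l hl := (periods τ).weierstrassP_add_coe z ⟨l, hl⟩
  analytic := (periods τ).analyticOnNhd_weierstrassP

lemma isElliptic_wp' : IsElliptic τ (wp' τ) where
  periodic z l hl := (periods τ).derivWeierstrassP_add_coe z ⟨l, hl⟩
  analytic := (periods τ).analyticOnNhd_derivWeierstrassP

lemma isElliptic_E (j : ℕ) : IsElliptic τ (E τ j) where
  periodic z l hl := by simp only [E, isElliptic_wp.periodic z l hl, isElliptic_wp'.periodic z l hl]
  analytic z hz := by
    unfold E
    split_ifs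
    · exact (isElliptic_wp.analytic z hz).pow _
    · exact (analyticAt_const.mul (isElliptic_wp'.analytic z hz)).mul
        ((isElliptic_wp.analytic z hz).pow _)

lemma wp_neg (z : ℂ) : wp τ (-z) = wp τ z := (periods τ).weierstrassP_neg z

lemma hasLeadingTerm_wp_sub : HasLeadingTerm (fun z => wp τ z - z ^ (-2 : ℤ)) 0 0 := by
  refine ⟨_, (periods τ).analyticAt_weierstrassPExcept 0, by simp, Eventually.of_forall fun z => ?_⟩
  have := (periods τ).weierstrassPExcept_def ⟨0, zero_mem _⟩ z
  simp only [sub_zero] at this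
  rw [wp, zpow_zero, one_mul, this]
  simp [zpow_neg, sub_eq_add_neg]

lemma hasLeadingTerm_wp : HasLeadingTerm (wp τ) (-2) 1 := by
  simpa using ((hasLeadingTerm_wp_sub (τ := τ)).of_lt (l := -2) (by norm_num)).add (.zpow (-2))

lemma hasLeadingTerm_wp' : HasLeadingTerm (wp' τ) (-3) (-2) := by
  have hsub : HasLeadingTerm (fun z => wp' τ z - (-2) * z ^ (-3 : ℤ)) 0 0 := by
    refine ⟨_, (periods τ).analyticAt_derivWeierstrassPExcept 0, by simp,
      Eventually.of_forall fun z => ?_⟩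
    have := (periods τ).derivWeierstrassPExcept_def ⟨0, zero_mem _⟩ z
    simp only [sub_zero] at this
    beta_reduce
    rw [zpow_zero, one_mul, this, zpow_neg, zpow_ofNat, wp']
    ring
  simpa using (hsub.of_lt (l := -3) (by norm_num)).add
    ((HasLeadingTerm.zpow (-3)).const_mul (-2))

lemma E_zero (z : ℂ) : E τ 0 z = 1 := by simp [E]

lemma E_three (z : ℂ) : E τ 3 z = -(wp' τ z) / 2 := by
  simp only [E, show ¬Even 3 by decide, if_false, Nat.sub_self, Nat.zero_div, pow_zero]
  ring

lemma E_neg (j : ℕ) (z : ℂ) : E τ j (-z) = (-1) ^ j * E τ j z := by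
  have hwp' : wp' τ (-z) = -wp' τ z := (periods τ).derivWeierstrassP_neg z
  rcases Nat.even_or_odd j with hj | hj
  · simp only [E, hj, if_true, wp_neg, hj.neg_one_pow, one_mul]
  · simp only [E, Nat.not_even_iff_odd.2 hj, if_false, wp_neg, hwp', hj.neg_one_pow]
    ring

lemma hasLeadingTerm_E {j : ℕ} (hj : j ≠ 1) : HasLeadingTerm (E τ j) (-j) 1 := by
  have hpow (m : ℕ) : HasLeadingTerm (fun z => wp τ z ^ m) (m * -2) 1 := by
    simpa only [one_pow] using (hasLeadingTerm_wp (τ := τ)).pow m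
  obtain ⟨m, rfl⟩ | ⟨m, rfl⟩ : (∃ m, j = 2 * m) ∨ ∃ m, j = 2 * m + 3 := by
    rcases Nat.even_or_odd' j with ⟨m, rfl | rfl⟩
    · exact .inl ⟨m, rfl⟩
    · exact .inr ⟨m - 1, by omega⟩
  · convert hpow m using 1
    · funext z
      simp [E]
    · push_cast
      ring
  · convert ((hasLeadingTerm_wp' (τ := τ)).const_mul (-(1 / 2))).mul (hpow m) using 1
    · funext z
      simp [E, show ¬Even (2 * m + 3) by grind]
    · push_cast
      ring
    · norm_num

/-- The degrees `{0, 2, 3, …, n - 1}` of the elliptic polynomials of degree less than `n`. -/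
abbrev degrees (n : ℕ) : Finset ℕ := (Finset.range n).erase 1

/-- The elliptic polynomial of degree less than `n` with coefficients `a` in the basis `E`. -/
noncomputable def ellipticPoly (τ : UpperHalfPlane) (n : ℕ) (a : ℕ → ℂ) (z : ℂ) : ℂ :=
  ∑ j ∈ degrees n, a j * E τ j z

lemma mem_degrees {j : ℕ} : j ∈ degrees n ↔ j ≠ 1 ∧ j < n := by simp

lemma degrees_succ (hn : n ≠ 1) : degrees (n + 1) = insert n (degrees n) := by
  ext j
  simp only [Finset.mem_insert, mem_degrees]
  omega

lemma notMem_degrees_self : n ∉ degrees n := by simp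

lemma ellipticPoly_succ (hn : n ≠ 1) (a : ℕ → ℂ) (z : ℂ) :
    ellipticPoly τ (n + 1) a z = a n * E τ n z + ellipticPoly τ n a z := by
  rw [ellipticPoly, degrees_succ hn, Finset.sum_insert notMem_degrees_self, ellipticPoly]

lemma ellipticPoly_update (a : ℕ → ℂ) (c z : ℂ) :
    ellipticPoly τ n (Function.update a n c) z = ellipticPoly τ n a z :=
  Finset.sum_congr rfl fun j hj => by
    rw [Function.update_of_ne (ne_of_mem_of_not_mem hj notMem_degrees_self)]

lemma isElliptic_ellipticPoly (n : ℕ) (a : ℕ → ℂ) : IsElliptic τ (ellipticPoly τ n a) where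
  periodic z l hl := by simp only [ellipticPoly, (isElliptic_E _).periodic z l hl]
  analytic z hz := Finset.analyticAt_fun_sum _ fun j _ =>
    analyticAt_const.mul ((isElliptic_E j).analytic z hz)

lemma hasLeadingTerm_ellipticPoly (n : ℕ) (a : ℕ → ℂ) :
    HasLeadingTerm (ellipticPoly τ n a) (-n) 0 := by
  rw [← Finset.sum_const_zero (s := degrees n)]
  refine .sum _ fun j hj => ?_
  rw [mem_degrees] at hj
  exact ((hasLeadingTerm_E hj.1).const_mul (a j)).of_lt (by omega)

lemma hasLeadingTerm_ellipticPoly_succ (hn : n ≠ 1) (a : ℕ → ℂ) :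
    HasLeadingTerm (ellipticPoly τ (n + 1) a) (-n) (a n) := by
  have := ((hasLeadingTerm_E (τ := τ) hn).const_mul (a n)).add
    (hasLeadingTerm_ellipticPoly (τ := τ) n a)
  simpa only [← ellipticPoly_succ hn, mul_one, add_zero] using this

/-- The gap at degree `1` is the residue theorem. -/
theorem SectionallyAnalytic.exists_eqOn_ellipticPoly (k : ℕ)
    (hF : SectionallyAnalytic τ F P P) (h0 : HasLeadingTerm F (-k) c) :
    ∃ a : ℕ → ℂ, (k ≠ 1 → a k = c) ∧ Set.EqOn F (ellipticPoly τ (k + 1) a) (domain τ) := by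
  induction k generalizing F P c with
  | zero =>
    refine ⟨fun _ => c, fun _ => rfl, fun z hz => ?_⟩
    simp [hF.eq_of_hasLeadingTerm_zero (by simpa using h0) hz, ellipticPoly, E_zero]
  | succ k ih =>
    have hk : -((k + 1 : ℕ) : ℤ) + 1 = -k := by push_cast; ring
    rcases eq_or_ne k 0 with rfl | hk0
    · have hres := hF.integral_above_sub_below h0
      simp only [sub_self, intervalIntegral.integral_zero] at hres
      obtain rfl := (mul_eq_zero.1 hres.symm).resolve_left Complex.two_pi_I_ne_zero
      obtain ⟨d, hd⟩ := h0.exists_succ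
      obtain ⟨a, -, ha⟩ := ih hF (hk ▸ hd)
      exact ⟨a, fun h => absurd rfl h, ha⟩
    · have hk1 : k + 1 ≠ 1 := by omega
      have hsub := h0.sub ((hasLeadingTerm_E (τ := τ) hk1).const_mul c)
      rw [mul_one, sub_self] at hsub
      obtain ⟨d, hd⟩ := hsub.exists_succ
      obtain ⟨a, -, ha⟩ := ih (hF.sub ((isElliptic_E (k + 1)).sectionallyAnalytic.const_mul c))
        (hk ▸ hd)
      refine ⟨Function.update a (k + 1) c, fun _ => Function.update_self .., fun z hz => ?_⟩
      rw [ellipticPoly_succ hk1, Function.update_self, ellipticPoly_update, ← ha hz,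
        add_sub_cancel]

end

section

/-- The bilinear form `∫_γ p q dz` with respect to which the elliptic polynomials `π_n` are
orthogonal. -/
noncomputable def pairing (τ : UpperHalfPlane) (p q : ℂ → ℂ) : ℂ := integralγ τ fun z => p z * q z

variable {τ : UpperHalfPlane} {q : ℂ → ℂ} {n : ℕ}

lemma pairing_comm (p q : ℂ → ℂ) : pairing τ p q = pairing τ q p := by
  simp only [pairing, mul_comm]

lemma pairing_ellipticPoly (hq : IsElliptic τ q) (n : ℕ) (a : ℕ → ℂ) :
    pairing τ q (ellipticPoly τ n a) = ∑ j ∈ degrees n, a j * pairing τ q (E τ j) := by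
  have hint (j : ℕ) : Continuous fun t : ℝ => a j * (q (γ τ t) * E τ j (γ τ t)) :=
    (hq.continuous_γ.mul (isElliptic_E j).continuous_γ).const_mul (a j)
  simp only [pairing, integralγ, ellipticPoly, Finset.mul_sum, mul_left_comm (q _)]
  rw [intervalIntegral.integral_finsetSum fun j _ => (hint j).intervalIntegrable _ _]
  simp only [intervalIntegral.integral_const_mul]

lemma pairing_ellipticPoly_succ (hn : n ≠ 1) (hq : IsElliptic τ q)
    (horth : ∀ i ∈ degrees n, pairing τ q (E τ i) = 0) (a : ℕ → ℂ) :
    pairing τ q (ellipticPoly τ (n + 1) a) = a n * pairing τ q (E τ n) := by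
  rw [pairing_ellipticPoly hq, degrees_succ hn, Finset.sum_insert notMem_degrees_self,
    Finset.sum_eq_zero fun i hi => by rw [horth i hi, mul_zero], add_zero]

lemma pairing_ellipticPoly_E (n : ℕ) (a : ℕ → ℂ) (i : ℕ) :
    pairing τ (ellipticPoly τ n a) (E τ i) = ∑ j : Idx n, moment τ i j * a j := by
  rw [pairing_comm, pairing_ellipticPoly (isElliptic_E i), ← Finset.sum_coe_sort]
  exact Finset.sum_congr rfl fun j _ => mul_comm _ _

lemma D_eq_zero_iff : D τ n = 0 ↔ ∃ a : ℕ → ℂ, (∃ j ∈ degrees n, a j ≠ 0) ∧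
    ∀ i ∈ degrees n, pairing τ (ellipticPoly τ n a) (E τ i) = 0 := by
  simp only [pairing_ellipticPoly_E]
  rw [D, ← Matrix.exists_mulVec_eq_zero_iff]
  constructor
  · rintro ⟨v, hv, hker⟩
    obtain ⟨a, rfl⟩ : ∃ a : ℕ → ℂ, (fun j : Idx n => a j) = v :=
      ⟨Function.extend Subtype.val v 0, funext (Subtype.val_injective.extend_apply v 0)⟩
    obtain ⟨j, hj⟩ := Function.ne_iff.1 hv
    exact ⟨a, ⟨j, j.2, hj⟩, fun i hi => congrFun hker ⟨i, hi⟩⟩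
  · rintro ⟨a, ⟨j, hj, haj⟩, horth⟩
    exact ⟨fun j => a j, Function.ne_iff.2 ⟨⟨j, hj⟩, haj⟩, funext fun i => horth i i.2⟩

lemma exists_ellipticPoly_orthogonal (hn : n ≠ 1) (hD : D τ n ≠ 0) : ∃ e : ℕ → ℂ, e n = 1 ∧
    ∀ i ∈ degrees n, pairing τ (ellipticPoly τ (n + 1) e) (E τ i) = 0 := by
  set A : Matrix (Idx n) (Idx n) ℂ := .of fun i j => moment τ i j
  set v : Idx n → ℂ := A⁻¹.mulVec fun i => -moment τ i n with hv
  have hAv (i : Idx n) : ∑ j : Idx n, moment τ i j * v j = -moment τ i n := by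
    have : A.mulVec v = fun i : Idx n => -moment τ i n := by
      rw [hv, Matrix.mulVec_mulVec, A.mul_nonsing_inv (isUnit_iff_ne_zero.2 hD), Matrix.one_mulVec]
    exact congrFun this i
  refine ⟨Function.update (Function.extend Subtype.val v 0) n 1, Function.update_self ..,
    fun i hi => ?_⟩
  rw [pairing_comm, pairing_ellipticPoly (isElliptic_E i), degrees_succ hn,
    Finset.sum_insert notMem_degrees_self, Function.update_self, one_mul, ← Finset.sum_coe_sort,
    ← sub_eq_zero_of_eq (hAv ⟨i, hi⟩), sub_neg_eq_add, add_comm]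
  refine congrArg₂ _ (Finset.sum_congr rfl fun j _ => ?_) rfl
  rw [Function.update_of_ne (mem_degrees.1 j.2).2.ne, Subtype.val_injective.extend_apply, mul_comm]
  rfl

/-- Splits off the largest degree. -/
def idxSuccEquiv (hn : n ≠ 1) : Idx n ⊕ Unit ≃ Idx (n + 1) where
  toFun := Sum.elim (fun i => ⟨i, by have := mem_degrees.1 i.2; exact mem_degrees.2 (by omega)⟩)
    fun _ => ⟨n, mem_degrees.2 (by omega)⟩
  invFun i := if hi : (i : ℕ) = n then .inr () else
    .inl ⟨i, by have := mem_degrees.1 i.2; exact mem_degrees.2 (by omega)⟩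
  left_inv i := by
    rcases i with i | i
    · simp [(mem_degrees.1 i.2).2.ne]
    · simp
  right_inv i := by
    by_cases hi : (i : ℕ) = n
    · simp [hi, ← Subtype.val_inj]
    · simp [hi]

/-- Adding multiples of the other columns to the last one makes the determinant defining `eop`
block triangular. -/
lemma eop_eq_ellipticPoly (hn : n ≠ 1) (hD : D τ n ≠ 0) {e : ℕ → ℂ} (he : e n = 1)
    (horth : ∀ i ∈ degrees n, pairing τ (ellipticPoly τ (n + 1) e) (E τ i) = 0) :
    eop τ n = ellipticPoly τ (n + 1) e := by
  funext z
  set A : Matrix (Idx (n + 1)) (Idx (n + 1)) ℂ :=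
    .of fun i j => if (i : ℕ) = n then E τ j z else moment τ i j
  set l : Idx (n + 1) := idxSuccEquiv hn (.inr ())
  have hcol : (fun i => ∑ j : Idx (n + 1), e j • A i j) =
      fun i : Idx (n + 1) => if (i : ℕ) = n then ellipticPoly τ (n + 1) e z else 0 := by
    funext i
    by_cases hi : (i : ℕ) = n
    · simp only [A, Matrix.of_apply, hi, if_true, smul_eq_mul, ellipticPoly]
      exact Finset.sum_coe_sort (degrees (n + 1)) fun j => e j * E τ j z
    · have hin : (i : ℕ) ∈ degrees n := by
        have := mem_degrees.1 i.2
        exact mem_degrees.2 (by omega)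
      simp only [A, Matrix.of_apply, hi, if_false, smul_eq_mul, ← horth i hin,
        pairing_ellipticPoly_E, mul_comm]
  have hblocks : (A.updateCol l fun i => ∑ j : Idx (n + 1), e j • A i j).submatrix
      (idxSuccEquiv hn) (idxSuccEquiv hn) =
        Matrix.fromBlocks (.of fun i j : Idx n => moment τ i j) 0
          (.of fun _ j => E τ j z) (.of fun _ _ => ellipticPoly τ (n + 1) e z) := by
    rw [hcol]
    ext (i | i) (j | j)
    · simp [idxSuccEquiv, A, l, (mem_degrees.1 i.2).2.ne, (mem_degrees.1 j.2).2.ne]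
    · simp [idxSuccEquiv, l, (mem_degrees.1 i.2).2.ne]
    · simp [idxSuccEquiv, A, l, (mem_degrees.1 j.2).2.ne]
    · simp [idxSuccEquiv, l]
  have hdet := A.det_updateCol_sum l fun j => e j
  rw [← Matrix.det_submatrix_equiv_self (idxSuccEquiv hn), hblocks, Matrix.det_fromBlocks_zero₁₂,
    Matrix.det_unique (n := Unit), Matrix.of_apply, show e l = 1 from he, one_smul] at hdet
  rw [eop, ← hdet]
  exact inv_mul_cancel_left₀ hD _

lemma exists_eop_eq_ellipticPoly (hn : n ≠ 1) (hD : D τ n ≠ 0) : ∃ e : ℕ → ℂ, e n = 1 ∧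
    eop τ n = ellipticPoly τ (n + 1) e ∧ ∀ i ∈ degrees n, pairing τ (eop τ n) (E τ i) = 0 := by
  obtain ⟨e, he, horth⟩ := exists_ellipticPoly_orthogonal hn hD
  have heop := eop_eq_ellipticPoly hn hD he horth
  exact ⟨e, he, heop, heop ▸ horth⟩

lemma pairing_eop (hn : n ≠ 1) (hD : D τ n ≠ 0) (a : ℕ → ℂ) :
    pairing τ (ellipticPoly τ (n + 1) a) (eop τ n) = a n * h τ n := by
  obtain ⟨e, he, heop, horth⟩ := exists_eop_eq_ellipticPoly hn hD
  have hell : IsElliptic τ (eop τ n) := heop ▸ isElliptic_ellipticPoly _ _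
  have hh : h τ n = pairing τ (eop τ n) (E τ n) := calc
    h τ n = pairing τ (eop τ n) (eop τ n) := by simp only [h, pairing, sq]
    _ = pairing τ (eop τ n) (E τ n) := by
      conv_lhs => arg 3; rw [heop]
      rw [pairing_ellipticPoly_succ hn hell horth, he, one_mul]
  rw [pairing_comm, pairing_ellipticPoly_succ hn hell horth, hh]

end

section

/-- `(u, v)` is a row of a solution of the Riemann-Hilbert problem of index `k` or `k + 1`, with
the leading terms `c z^(-k)` and `d z^(k-1)` at the origin: the first row at index `k` has `c = 1`,
and the second row at index `k + 1` has `d = 1`. -/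
structure IsRow (τ : UpperHalfPlane) (k : ℕ) (c d : ℂ) (u v : ℂ → ℂ) : Prop where
  jump : ∃ P M, SectionallyAnalytic τ u P P ∧ SectionallyAnalytic τ v (fun t => M t + P t) M
  fst : HasLeadingTerm u (-k) c
  snd : HasLeadingTerm v (k - 1) d

variable {τ : UpperHalfPlane} {k k' : ℕ} {c d c' d' : ℂ} {u v u' v' : ℂ → ℂ}

namespace IsRow

lemma sub (hr : IsRow τ k c d u v) (hr' : IsRow τ k c' d' u' v') :
    IsRow τ k (c - c') (d - d') (fun z => u z - u' z) (fun z => v z - v' z) where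
  jump := by
    obtain ⟨P, M, hu, hv⟩ := hr.jump
    obtain ⟨P', M', hu', hv'⟩ := hr'.jump
    refine ⟨_, fun t => M t - M' t, hu.sub hu', ?_⟩
    simpa only [add_sub_add_comm] using hv.sub hv'
  fst := hr.fst.sub hr'.fst
  snd := hr.snd.sub hr'.snd

lemma const_mul (hr : IsRow τ k c d u v) (s : ℂ) :
    IsRow τ k (s * c) (s * d) (fun z => s * u z) (fun z => s * v z) where
  jump := by
    obtain ⟨P, M, hu, hv⟩ := hr.jump
    refine ⟨_, fun t => s * M t, hu.const_mul s, ?_⟩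
    simpa only [mul_add] using hv.const_mul s
  fst := hr.fst.const_mul s
  snd := hr.snd.const_mul s

/-- Reflection in the origin exchanges the two sides of the contour, hence the extra sign. -/
lemma comp_neg (hr : IsRow τ k c d u v) :
    IsRow τ k c d (fun z => (-1) ^ k * u (-z)) (fun z => (-1) ^ (k + 1) * v (-z)) where
  jump := by
    obtain ⟨P, M, hu, hv⟩ := hr.jump
    refine ⟨_, fun t => (-1) ^ (k + 1) * (M (-t) + P (-t)), hu.comp_neg.const_mul _, ?_⟩
    convert hv.comp_neg.const_mul ((-1) ^ (k + 1)) using 2 with t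
    ring
  fst := by
    convert hr.fst.comp_neg.const_mul ((-1) ^ k) using 1
    rw [← mul_assoc, ← zpow_natCast, ← zpow_add₀ (by norm_num), add_neg_cancel, zpow_zero, one_mul]
  snd := by
    convert hr.snd.comp_neg.const_mul ((-1) ^ (k + 1)) using 1
    rw [← mul_assoc, ← zpow_natCast, ← zpow_add₀ (by norm_num), Nat.cast_succ,
      add_add_sub_cancel, ← two_mul, zpow_mul]
    simp

/-- The residue theorem for `v q`, whose jump across the contour is `u q`. -/
lemma exists_pairing_eq (hr : IsRow τ k c d u v) : ∃ a : ℕ → ℂ, (k ≠ 1 → a k = c) ∧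
    Set.EqOn u (ellipticPoly τ (k + 1) a) (domain τ) ∧
    ∀ q e, IsElliptic τ q → HasLeadingTerm q (-k) e →
      pairing τ (ellipticPoly τ (k + 1) a) q = 2 * Real.pi * Complex.I * (d * e) := by
  obtain ⟨P, M, hu, hv⟩ := hr.jump
  obtain ⟨a, ha, hua⟩ := hu.exists_eqOn_ellipticPoly k hr.fst
  refine ⟨a, ha, hua, fun q e hq hqe => ?_⟩
  have hpole : HasLeadingTerm (fun z => v z * q z) (-1) (d * e) := by
    convert hr.snd.mul hqe using 1
    ring
  rw [← (hv.mul hq.sectionallyAnalytic).integral_above_sub_below hpole, pairing, integralγ]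
  simp only [add_mul, add_sub_cancel_left,
    hu.eq_of_eqOn_domain (isElliptic_ellipticPoly (k + 1) a) hua]

lemma mul_h (hr : IsRow τ k c d u v) (hk : k ≠ 1) (hD : D τ k ≠ 0) :
    c * h τ k = 2 * Real.pi * Complex.I * d := by
  obtain ⟨a, ha, -, hpair⟩ := hr.exists_pairing_eq
  obtain ⟨e, he, heop, -⟩ := exists_eop_eq_ellipticPoly hk hD
  rw [← ha hk, ← pairing_eop hk hD, heop,
    hpair _ _ (isElliptic_ellipticPoly _ _) (hasLeadingTerm_ellipticPoly_succ hk e), he, mul_one]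

lemma eq_zero_of_D_eq_zero (hr : IsRow τ k c d u v) (hk : k ≠ 1) (hD : D τ k = 0)
    (hD' : D τ (k + 1) ≠ 0) : c = 0 := by
  obtain ⟨a, ha, -, hpair⟩ := hr.exists_pairing_eq
  obtain ⟨p, ⟨j, hj, hpj⟩, horth⟩ := D_eq_zero_iff.1 hD
  set q := ellipticPoly τ k p
  have hq : IsElliptic τ q := isElliptic_ellipticPoly k p
  have hqE : c * pairing τ q (E τ k) = 0 := by
    rw [← ha hk, ← pairing_ellipticPoly_succ hk hq horth, pairing_comm,
      hpair q 0 hq (hasLeadingTerm_ellipticPoly k p), mul_zero, mul_zero]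
  by_contra hc
  refine hD' (D_eq_zero_iff.2 ⟨Function.update p k 0, ⟨j, ?_, ?_⟩, ?_⟩)
  · exact degrees_succ hk ▸ Finset.mem_insert_of_mem hj
  · rwa [Function.update_of_ne (mem_degrees.1 hj).2.ne]
  · have hupd : ellipticPoly τ (k + 1) (Function.update p k 0) = q := by
      funext z
      rw [ellipticPoly_succ hk, Function.update_self, zero_mul, zero_add, ellipticPoly_update]
    rw [hupd, degrees_succ hk]
    exact Finset.forall_mem_insert _ _ _ |>.2 ⟨(mul_eq_zero.1 hqE).resolve_left hc, horth⟩

lemma eq_zero_of_D_succ_ne_zero (hr : IsRow τ k c 0 u v) (hk : 1 ≤ k) (hD : D τ (k + 1) ≠ 0)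
    {z : ℂ} (hz : z ∈ domain τ) : u z = 0 ∧ v z = 0 := by
  obtain ⟨a, -, hua, hpair⟩ := hr.exists_pairing_eq
  have ha : ∀ j ∈ degrees (k + 1), a j = 0 := by
    by_contra! hne
    refine hD (D_eq_zero_iff.2 ⟨a, hne, fun i hi => ?_⟩)
    obtain ⟨e, he⟩ : ∃ e, HasLeadingTerm (E τ i) (-k) e := by
      rw [mem_degrees] at hi
      rcases eq_or_ne i k with rfl | hik
      · exact ⟨1, hasLeadingTerm_E hi.1⟩
      · exact ⟨0, (hasLeadingTerm_E hi.1).of_lt (by omega)⟩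
    rw [hpair _ e (isElliptic_E i) he, zero_mul, mul_zero]
  have hpoly (z : ℂ) : ellipticPoly τ (k + 1) a z = 0 :=
    Finset.sum_eq_zero fun j hj => by rw [ha j hj, zero_mul]
  obtain ⟨P, M, hu, hv⟩ := hr.jump
  simp only [hu.eq_of_eqOn_domain (isElliptic_ellipticPoly _ a) hua, hpoly, add_zero] at hv
  refine ⟨(hua hz).trans (hpoly z), hv.eq_of_hasLeadingTerm_zero ?_ hz⟩
  rcases hk.eq_or_lt with rfl | hk
  · simpa using hr.snd
  · exact hr.snd.of_lt (by omega)

lemma eq_zero (hr : IsRow τ k 0 0 u v) (hk : 2 ≤ k) (hD : D τ k ≠ 0 ∨ D τ (k + 1) ≠ 0)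
    {z : ℂ} (hz : z ∈ domain τ) : u z = 0 ∧ v z = 0 := by
  rcases hD with hD | hD
  · obtain ⟨k, rfl⟩ : ∃ l, k = l + 1 := ⟨k - 1, by omega⟩
    obtain ⟨c, hc⟩ := hr.fst.exists_succ
    have hr' : IsRow τ k c 0 u v :=
      ⟨hr.jump, by simpa using hc, hr.snd.of_lt (by omega)⟩
    exact hr'.eq_zero_of_D_succ_ne_zero (by omega) hD hz
  · exact hr.eq_zero_of_D_succ_ne_zero (by omega) hD hz

lemma parity (hr : IsRow τ k c d u v) (hk : 2 ≤ k) (hD : D τ k ≠ 0 ∨ D τ (k + 1) ≠ 0) {z : ℂ}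
    (hz : z ∈ domain τ) : u (-z) = (-1) ^ k * u z ∧ v (-z) = (-1) ^ (k + 1) * v z := by
  have hdiff := hr.comp_neg.sub hr
  rw [sub_self, sub_self] at hdiff
  have hzero := hdiff.eq_zero hk hD (neg_mem_domain hz)
  simp only [neg_neg, sub_eq_zero] at hzero
  exact hzero.imp Eq.symm Eq.symm

lemma exists_cross (hr : IsRow τ k c d u v) (hr' : IsRow τ k' c' d' u' v') :
    ∃ P, SectionallyAnalytic τ (fun z => u z * v' z - v z * u' z) P P := by
  obtain ⟨P, M, hu, hv⟩ := hr.jump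
  obtain ⟨P', M', hu', hv'⟩ := hr'.jump
  refine ⟨fun t => P t * M' t - M t * P' t, ?_⟩
  convert (hu.mul hv').sub (hv.mul hu') using 2 with t
  ring

end IsRow

end

section

variable {τ : UpperHalfPlane} {k n : ℕ} {a b c c' d : ℂ} {u v u' v' : ℂ → ℂ}

namespace IsRow

lemma exists_sub_zpow_fst (hr : IsRow τ k c d u v) (hk : 2 ≤ k)
    (hD : D τ k ≠ 0 ∨ D τ (k + 1) ≠ 0) :
    ∃ e, HasLeadingTerm (fun z => u z - c * z ^ (-k : ℤ)) (-k + 2) e := by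
  have hsign : (-1 : ℂ) ^ (-k : ℤ) = (-1) ^ k := by
    rw [zpow_neg, zpow_natCast, ← inv_pow, inv_neg_one]
  exact hr.fst.exists_sub_zpow_of_parity <| eventually_mem_domain.mono fun z hz => by
    rw [(hr.parity hk hD hz).1, hsign]

lemma exists_sub_zpow_snd (hr : IsRow τ k c d u v) (hk : 2 ≤ k)
    (hD : D τ k ≠ 0 ∨ D τ (k + 1) ≠ 0) :
    ∃ e, HasLeadingTerm (fun z => v z - d * z ^ (k - 1 : ℤ)) (k - 1 + 2) e := by
  have hsign : (-1 : ℂ) ^ (k - 1 : ℤ) = (-1) ^ (k + 1) := by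
    rw [zpow_sub_one₀ (by norm_num), zpow_natCast, inv_neg_one, pow_succ]
  exact hr.snd.exists_sub_zpow_of_parity <| eventually_mem_domain.mono fun z hz => by
    rw [(hr.parity hk hD hz).2, hsign]

lemma cross_eq_wp_add (hr : IsRow τ (k + 1) 1 b u v) (hr' : IsRow τ k a 1 u' v')
    (hu : HasLeadingTerm (fun z => u z - z ^ (-(k + 1 : ℕ) : ℤ)) (-(k + 1 : ℕ) + 2) c)
    (hv' : HasLeadingTerm (fun z => v' z - z ^ (k - 1 : ℤ)) (k - 1 + 2) c') {z : ℂ}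
    (hz : z ∈ domain τ) : u z * v' z - v z * u' z = wp τ z + (c + c' - b * a) := by
  obtain ⟨P, hP⟩ := hr.exists_cross hr'
  have hprod : HasLeadingTerm (fun z => (u z - z ^ (-(k + 1 : ℕ) : ℤ)) * v' z) 0 c := by
    convert hu.mul hr'.snd using 1 <;> push_cast <;> ring
  have hprod' :
      HasLeadingTerm (fun z => z ^ (-(k + 1 : ℕ) : ℤ) * (v' z - z ^ (k - 1 : ℤ))) 0 c' := by
    convert (HasLeadingTerm.zpow (-(k + 1 : ℕ))).mul hv' using 1 <;> push_cast <;> ring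
  have hanti : HasLeadingTerm (fun z => v z * u' z) 0 (b * a) := by
    convert hr.snd.mul hr'.fst using 1
    push_cast
    ring
  have hdiff : HasLeadingTerm (fun z => u z * v' z - v z * u' z - wp τ z) 0 (c + c' - b * a) := by
    have hsum := ((hprod.add hprod').sub hanti).sub (hasLeadingTerm_wp_sub (τ := τ))
    rw [sub_zero] at hsum
    refine hsum.congr ?_
    filter_upwards [self_mem_nhdsWithin] with z hz0
    have hpow : z ^ (-(k + 1 : ℕ) : ℤ) * z ^ (k - 1 : ℤ) = z ^ (-2 : ℤ) := by
      rw [← zpow_add₀ hz0]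
      congr 1
      push_cast
      ring
    linear_combination -hpow
  exact sub_eq_iff_eq_add'.1
    ((hP.sub isElliptic_wp.sectionallyAnalytic).eq_of_hasLeadingTerm_zero hdiff hz)

lemma cross_eq_wp' (hr : IsRow τ (k + 2) 1 b u v) (hr' : IsRow τ k a 1 u' v') (hk : 2 ≤ k)
    (hD : D τ (k + 1) ≠ 0) (hD' : D τ (k + 2) ≠ 0) {z : ℂ} (hz : z ∈ domain τ) :
    u z * v' z - v z * u' z = -(wp' τ z) / 2 := by
  obtain ⟨P, hP⟩ := hr.exists_cross hr'
  have hprod : HasLeadingTerm (fun z => u z * v' z) (-(3 : ℕ)) 1 := by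
    convert hr.fst.mul hr'.snd using 1 <;> push_cast <;> ring
  have hanti : HasLeadingTerm (fun z => v z * u' z) (-(3 : ℕ)) 0 :=
    (hr.snd.mul hr'.fst).of_lt (by push_cast; linarith)
  obtain ⟨e, he⟩ : ∃ e, HasLeadingTerm (fun z => u z * v' z - v z * u' z - E τ 3 z) (-2) e := by
    have hdiff := (hprod.sub hanti).sub (hasLeadingTerm_E (τ := τ) (by norm_num : 3 ≠ 1))
    rw [sub_zero, sub_self] at hdiff
    exact hdiff.exists_succ
  rw [← E_three, ← sub_eq_zero]
  refine (hP.sub (isElliptic_E 3).sectionallyAnalytic).eq_zero_of_odd he (fun w hw => ?_) hz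
  obtain ⟨hu, hv⟩ := hr.parity (by omega) (.inl hD') hw
  obtain ⟨hu', hv'⟩ := hr'.parity hk (.inr hD) hw
  have hsign : (-1 : ℂ) ^ k * (-1) ^ k = 1 := by rw [← mul_pow]; simp
  rw [hu, hv, hu', hv', E_neg]
  linear_combination (v w * u' w - u w * v' w) * hsign

lemma h_ne_zero (hr : IsRow τ k a 1 u v) (hk : k ≠ 1) (hD : D τ k ≠ 0) : h τ k ≠ 0 := by
  refine right_ne_zero_of_mul (a := a) ?_
  rw [hr.mul_h hk hD, mul_one]
  exact Complex.two_pi_I_ne_zero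

lemma mul_eq_div_h (hr : IsRow τ (k + 1) 1 b u v) (hr' : IsRow τ k a 1 u' v') (hk : 2 ≤ k)
    (hD : D τ (k + 1) ≠ 0) : b * a = if D τ k = 0 then 0 else h τ (k + 1) / h τ k := by
  split_ifs with hDk
  · rw [hr'.eq_zero_of_D_eq_zero (by omega) hDk hD, mul_zero]
  · have hk1 : k ≠ 1 := by omega
    rw [eq_div_iff (hr'.h_ne_zero hk1 hDk), mul_assoc, hr'.mul_h hk1 hDk,
      ← one_mul (h τ (k + 1)), hr.mul_h (by omega) hD]
    ring

lemma eq_mul (hr : IsRow τ k 1 b u v) (hr' : IsRow τ k a 1 u' v') (hk : 2 ≤ k) (hD : D τ k ≠ 0)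
    {z : ℂ} (hz : z ∈ domain τ) :
    u' z = 2 * Real.pi * Complex.I / h τ k * u z ∧
      v' z = 2 * Real.pi * Complex.I / h τ k * v z := by
  have hk1 : k ≠ 1 := by omega
  have hh := hr'.h_ne_zero hk1 hD
  have ha : a = 2 * Real.pi * Complex.I / h τ k := by
    rw [eq_div_iff hh, hr'.mul_h hk1 hD, mul_one]
  have hab : a * b = 1 := by
    rw [ha, div_mul_eq_mul_div, ← hr.mul_h hk1 hD, one_mul, div_self hh]
  have hdiff := hr'.sub (hr.const_mul a)
  rw [mul_one, sub_self, hab, sub_self] at hdiff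
  rw [← ha]
  exact (hdiff.eq_zero hk (.inl hD) hz).imp sub_eq_zero.1 sub_eq_zero.1

end IsRow

lemma tendsto_of_tendsto_fract {X : Type*} {F : ℂ → X}
    (hF : ∀ z ∈ domain τ, ∀ l ∈ Λ τ, F (z + l) = F z) {s s' : Set ℂ} {t : ℝ} {L : Filter X}
    (hs : ∀ z ∈ s, z.im ≠ (γ τ t).im)
    (hss' : Set.MapsTo (fun z : ℂ => z + ((-⌊t⌋ : ℤ) : ℂ)) s s')
    (hL : Tendsto F (𝓝[s'] γ τ (Int.fract t)) L) : Tendsto F (𝓝[s] γ τ t) L := by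
  have hshift : Tendsto (fun z : ℂ => z + ((-⌊t⌋ : ℤ) : ℂ)) (𝓝[s] γ τ t)
      (𝓝[s'] γ τ (Int.fract t)) := by
    have hγ : γ τ t + ((-⌊t⌋ : ℤ) : ℂ) = γ τ (Int.fract t) := by
      simp only [γ, Int.fract, Complex.ofReal_sub, Complex.ofReal_intCast, Int.cast_neg]
      ring
    exact hγ ▸ (Continuous.continuousWithinAt (by fun_prop)).tendsto_nhdsWithin hss'
  refine (hL.comp hshift).congr' ?_
  filter_upwards [eventually_nhdsWithin_of_eventually_nhds (eventually_mem_domain_of_im_ne t),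
    self_mem_nhdsWithin] with z hz hzs
  exact hF _ (hz (hs z hzs)) _ (intCast_mem_Λ _)

namespace IsRHPSolution

variable {Y : ℂ → Matrix (Fin 2) (Fin 2) ℂ}

lemma exists_limits (hY : IsRHPSolution τ n Y) : ∃ P M : ℝ → Matrix (Fin 2) (Fin 2) ℂ,
    (∀ i j, SectionallyAnalytic τ (fun z => Y z i j) (fun t => P t i j) fun t => M t i j) ∧
      ∀ t, P t = M t * !![1, 1; 0, 1] := by
  choose P M hP hM hjump using fun t : ℝ =>
    hY.jump (Int.fract t) ⟨Int.fract_nonneg t, (Int.fract_lt_one t).le⟩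
  have hentry (i j : Fin 2) (A : Matrix (Fin 2) (Fin 2) ℂ) :
      Tendsto (fun A : Matrix (Fin 2) (Fin 2) ℂ => A i j) (𝓝 A) (𝓝 (A i j)) :=
    (continuous_id.matrix_elem i j).tendsto A
  refine ⟨P, M, fun i j => ⟨fun z hz l hl => by rw [hY.periodic z hz l hl], hY.analytic i j,
    fun t => (hentry i j _).comp ?_, fun t => (hentry i j _).comp ?_⟩, hjump⟩
  · exact tendsto_of_tendsto_fract hY.periodic (fun _ hz => ne_of_gt hz)
      (fun z hz => by simpa [γ_im] using hz) (hP t)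
  · exact tendsto_of_tendsto_fract hY.periodic (fun _ hz => ne_of_lt hz)
      (fun z hz => by simpa [γ_im] using hz) (hM t)

lemma hasLeadingTerm (hY : IsRHPSolution τ n Y) (i j : Fin 2) :
    HasLeadingTerm (fun z => Y z i j) ((![-n, n - 2] : Fin 2 → ℤ) j)
      ((1 : Matrix (Fin 2) (Fin 2) ℂ) i j) := by
  refine .of_isBigO (eventually_mem_domain.mono fun z hz =>
    (hY.analytic i j z hz).differentiableAt) ((hY.asymp i j).congr_left fun z => ?_)
  rw [Matrix.mul_diagonal, mul_comm]
  fin_cases j <;> simp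

lemma exists_isRow (hY : IsRHPSolution τ (k + 1) Y) : ∃ a b,
    IsRow τ (k + 1) 1 b (fun z => Y z 0 0) (fun z => Y z 0 1) ∧
      IsRow τ k a 1 (fun z => Y z 1 0) (fun z => Y z 1 1) := by
  obtain ⟨P, M, hPM, hjump⟩ := hY.exists_limits
  have hlim (i : Fin 2) : ∃ p m, SectionallyAnalytic τ (fun z => Y z i 0) p p ∧
      SectionallyAnalytic τ (fun z => Y z i 1) (fun t => m t + p t) m := by
    refine ⟨fun t => M t i 0, fun t => M t i 1, ?_, ?_⟩
    · simpa [hjump, Matrix.mul_apply, Fin.sum_univ_two] using hPM i 0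
    · simpa [hjump, Matrix.mul_apply, Fin.sum_univ_two, add_comm] using hPM i 1
  have hfst (i : Fin 2) : HasLeadingTerm (fun z => Y z i 0) (-(k + 1 : ℕ))
      ((1 : Matrix (Fin 2) (Fin 2) ℂ) i 0) := hY.hasLeadingTerm i 0
  have hsnd (i : Fin 2) : HasLeadingTerm (fun z => Y z i 1) (k - 1)
      ((1 : Matrix (Fin 2) (Fin 2) ℂ) i 1) := by
    convert hY.hasLeadingTerm i 1 using 1
    change (k - 1 : ℤ) = (k + 1 : ℕ) - 2
    omega
  obtain ⟨a, ha⟩ := (hfst 1).exists_succ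
  obtain ⟨b, hb⟩ := (hsnd 0).exists_succ
  exact ⟨a, b, ⟨hlim 0, hfst 0, by simpa using hb⟩, ⟨hlim 1, by simpa using ha, hsnd 1⟩⟩

lemma exists_det_eq_wp_add (hY : IsRHPSolution τ n Y) (hn : 3 ≤ n) (hD : D τ n ≠ 0) :
    ∃ α, IsAlpha τ n Y α ∧ ∀ z ∈ domain τ, (Y z).det = wp τ z + α := by
  obtain ⟨k, rfl⟩ : ∃ k, n = k + 1 := ⟨n - 1, by omega⟩
  have hk : 2 ≤ k := by omega
  obtain ⟨a, b, hr, hr'⟩ := hY.exists_isRow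
  obtain ⟨c, hc⟩ := hr.exists_sub_zpow_fst (by omega) (.inl hD)
  obtain ⟨c', hc'⟩ := hr'.exists_sub_zpow_snd hk (.inr hD)
  simp only [one_mul] at hc hc'
  refine ⟨c + c' - b * a, ⟨c, c', ?_, ?_, ?_⟩, fun z hz => ?_⟩
  · simpa only [neg_neg] using hc.isBigO_zpow_mul_sub
  · convert hc'.isBigO_zpow_mul_sub using 5
    push_cast
    ring
  · rw [hr.mul_eq_div_h hr' hk hD, Nat.add_sub_cancel]
  · rw [Matrix.det_fin_two, hr.cross_eq_wp_add hr' hc hc' hz]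

end IsRHPSolution

lemma eq_R_mul {f f₁ : ℂ → ℂ} {z : ℂ} {A B : Matrix (Fin 2) (Fin 2) ℂ} (hf : f z = A.det)
    (hf₁ : f₁ z = B.det) (hA : A.det ≠ 0) (hh : h τ n ≠ 0)
    (hrow : ∀ j, B 1 j = 2 * Real.pi * Complex.I / h τ n * A 0 j)
    (hcross : B 0 0 * A 1 1 - B 0 1 * A 1 0 = -(wp' τ z) / 2) : B = R τ n f f₁ z * A := by
  have hs : h τ n / (2 * Real.pi * Complex.I) * (2 * Real.pi * Complex.I / h τ n) = 1 := by
    rw [← inv_div (h τ n), mul_inv_cancel₀ (div_ne_zero hh Complex.two_pi_I_ne_zero)]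
  rw [R, hf, hf₁, ← hcross, Matrix.smul_mul, eq_comm, one_div, inv_smul_eq_iff₀ hA,
    Matrix.det_fin_two, Matrix.det_fin_two, hrow, hrow]
  ext i j
  fin_cases i <;> fin_cases j <;>
    simp only [Fin.zero_eta, Fin.mk_one, Fin.isValue, Matrix.mul_apply, Fin.sum_univ_two,
      Matrix.of_apply, Matrix.cons_val_zero, Matrix.cons_val_one, Matrix.smul_apply,
      Matrix.cons_val', Matrix.cons_val_fin_one, smul_eq_mul, zero_mul, add_zero, hrow]
  · linear_combination (B 0 1 * A 0 0 - B 0 0 * A 0 1) * A 1 0 * hs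
  · linear_combination (B 0 1 * A 0 0 - B 0 0 * A 0 1) * A 1 1 * hs
  · ring
  · ring

end

end EllipticOP

theorem proposition3p1 (τ : UpperHalfPlane) (n : ℕ) (hn : 3 ≤ n)
    (hD : EllipticOP.D τ n ≠ 0) (hD₁ : EllipticOP.D τ (n + 1) ≠ 0)
    (Y Y₁ : ℂ → Matrix (Fin 2) (Fin 2) ℂ)
    (hY : EllipticOP.IsRHPSolution τ n Y) (hY₁ : EllipticOP.IsRHPSolution τ (n + 1) Y₁) :
    (∀ z ∈ EllipticOP.domain τ, (Y z).det ≠ 0 →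
      Y₁ z = EllipticOP.R τ n (fun w => (Y w).det) (fun w => (Y₁ w).det) z * Y z) ∧
    (∃ α : ℂ, EllipticOP.IsAlpha τ n Y α ∧
      ∀ z ∈ EllipticOP.domain τ, (Y z).det = EllipticOP.wp τ z + α) ∧
    (∃ α₁ : ℂ, EllipticOP.IsAlpha τ (n + 1) Y₁ α₁ ∧
      ∀ z ∈ EllipticOP.domain τ, (Y₁ z).det = EllipticOP.wp τ z + α₁) := by
  refine ⟨fun z hz hdet => ?_, hY.exists_det_eq_wp_add hn hD,
    hY₁.exists_det_eq_wp_add (by omega) hD₁⟩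
  obtain ⟨k, rfl⟩ : ∃ k, n = k + 1 := ⟨n - 1, by omega⟩
  obtain ⟨a, b, hfst, hsnd⟩ := hY.exists_isRow
  obtain ⟨a₁, b₁, hfst₁, hsnd₁⟩ := hY₁.exists_isRow
  refine EllipticOP.eq_R_mul rfl rfl hdet (hsnd₁.h_ne_zero (by omega) hD) ?_
    (hfst₁.cross_eq_wp' hsnd (by omega) hD hD₁ hz)
  exact Fin.forall_fin_two.2 (hfst.eq_mul hsnd₁ (by omega) hD hz)
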